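/- \textbf{Lemma (Row PCP).} For a real matrix $M$ write $\|M\|_F^2=\sum_{i,j}M_{ij}^2$, let $M_k$ be a best approximation of $M$ in Frobenius norm among matrices of rank at most $k$, let $M^+$ be the Moore--Penrose pseudoinverse, and let $$\tau_i^{k}(M)=a_i^T\Big(MM^T+\tfrac{\|M-M_k\|_F^2}{k}I\Big)^{+}a_i$$ be the $i$-th rank-$k$ (column) ridge leverage score, where $a_i$ is the $i$-th column of $M$. There are absolute constants $c_0,c_0'>0$ such that the following holds for all $c\ge c_0$ and $c'\ge c_0'$. Let $A\in\mathbb{R}^{n\times n}$ be positive semidefinite, let $k\ge 1$ be an integer, and let $0<\epsilon\le 1$ with $k/\epsilon\le n$. Put $k'=\lceil ck/\epsilon\rceil$, let $\tilde\tau_i\ge\tau_i^{k'}(A^{1/2})$ for $i=1,\dots,n$ be arbitrary overestimates, and set $$\tilde\ell_i=\sqrt{\tfrac{16n\epsilon}{k}}\;\tilde\tau_i,\qquad p_i=\frac{\tilde\ell_i}{\sum_{i'}\tilde\ell_{i'}},\qquad t=\Big\lceil \frac{c'\log n}{\epsilon^2}\sum_i\tilde\ell_i\Big\rceil .$$ Let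 $S_1,S_2\in\mathbb{R}^{n\times t}$ be random matrices whose $2t$ columns are independent, each column being equal to $\frac{1}{\sqrt{t\,p_i}}\,e_i$ with probability $p_i$ (if $t=0$ the matrices have no columns), and let $\tilde A=S_2^TAS_1$. Then, with probability at least $99/100$ over $S_1,S_2$, there is a number $\Delta$ with $|\Delta|\le 600\,\|A-A_k\|_F^2$ such that for every rank-$k$ orthogonal projection $P\in\mathbb{R}^{t\times t}$ $$(1-\epsilon)\,\|AS_1(I-P)\|_F^2\;\le\;\|\tilde A(I-P)\|_F^2+\Delta\;\le\;(1+\epsilon)\,\|AS_1(I-P)\|_F^2 .$$ -/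

import Mathlib

open MeasureTheory ProbabilityTheory
open scoped MatrixOrder

/-- The squared Frobenius norm `‖M‖_F² = ∑_{i,j} M_{ij}²`. -/
noncomputable def frobSq {m n : ℕ} (M : Matrix (Fin m) (Fin n) ℝ) : ℝ :=
  ∑ i, ∑ j, M i j ^ 2

/-- `‖M - M_k‖_F²`, the squared Frobenius error of a best approximation of `M` among the matrices
of rank at most `k`. -/
noncomputable def tailSq {m n : ℕ} (M : Matrix (Fin m) (Fin n) ℝ) (k : ℕ) : ℝ :=
  sInf {x : ℝ | ∃ B : Matrix (Fin m) (Fin n) ℝ, B.rank ≤ k ∧ x = frobSq (M - B)}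

/-- `X` is a Moore–Penrose pseudoinverse of the real matrix `M`. -/
structure IsMoorePenrose {m n : ℕ} (M : Matrix (Fin m) (Fin n) ℝ)
    (X : Matrix (Fin n) (Fin m) ℝ) : Prop where
  mul_mul : M * X * M = M
  mul_mul' : X * M * X = X
  symm_left : (M * X).transpose = M * X
  symm_right : (X * M).transpose = X * M

theorem IsMoorePenrose.unique {m n : ℕ} {M : Matrix (Fin m) (Fin n) ℝ}
    {X Y : Matrix (Fin n) (Fin m) ℝ} (hX : IsMoorePenrose M X) (hY : IsMoorePenrose M Y) :
    X = Y := by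
  have h1 : M * X = M * Y := by
    calc M * X = (M * X).transpose := hX.symm_left.symm
      _ = ((M * Y) * (M * X)).transpose := by
          rw [← Matrix.mul_assoc (M * Y) M X, hY.mul_mul]
      _ = (M * X) * (M * Y) := by rw [Matrix.transpose_mul, hX.symm_left, hY.symm_left]
      _ = M * Y := by rw [← Matrix.mul_assoc (M * X) M Y, hX.mul_mul]
  have h2 : X * M = Y * M := by
    calc X * M = (X * M).transpose := hX.symm_right.symm
      _ = ((X * M) * (Y * M)).transpose := by
          rw [Matrix.mul_assoc X M (Y * M), ← Matrix.mul_assoc M Y M, hY.mul_mul]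
      _ = (Y * M) * (X * M) := by rw [Matrix.transpose_mul, hX.symm_right, hY.symm_right]
      _ = Y * M := by rw [Matrix.mul_assoc Y M (X * M), ← Matrix.mul_assoc M X M, hX.mul_mul]
  calc X = X * M * X := hX.mul_mul'.symm
    _ = Y * (M * X) := by rw [h2, Matrix.mul_assoc]
    _ = Y := by rw [h1, ← Matrix.mul_assoc, hY.mul_mul']

theorem exists_isMoorePenrose {m n : ℕ} (M : Matrix (Fin m) (Fin n) ℝ) :
    ∃ X, IsMoorePenrose M X := by
  set G : Matrix (Fin n) (Fin n) ℝ := M.transpose * M with hG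
  have hGs : IsSelfAdjoint G := by
    rw [isSelfAdjoint_iff, Matrix.star_eq_conjTranspose, Matrix.conjTranspose_eq_transpose_of_trivial,
      hG, Matrix.transpose_mul, Matrix.transpose_transpose]
  have hc : ∀ f : ℝ → ℝ, ContinuousOn f (spectrum ℝ G) := fun f =>
    (Matrix.finite_real_spectrum (A := G)).continuousOn f
  set H : Matrix (Fin n) (Fin n) ℝ := cfc (fun x : ℝ => x⁻¹) G with hH
  have hid : cfc (fun x : ℝ => x) G = G := cfc_id' ℝ G
  have hHs : H.transpose = H := by
    have : IsSelfAdjoint H := cfc_predicate _ G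
    rwa [isSelfAdjoint_iff, Matrix.star_eq_conjTranspose,
      Matrix.conjTranspose_eq_transpose_of_trivial] at this
  have hGt : G.transpose = G := by
    rw [hG, Matrix.transpose_mul, Matrix.transpose_transpose]
  have hHG : H * G = cfc (fun x : ℝ => x⁻¹ * x) G := by
    rw [cfc_mul _ _ _ (hc _) (hc _), hid]
  have hGH : G * H = cfc (fun x : ℝ => x⁻¹ * x) G := by
    have : (fun x : ℝ => x⁻¹ * x) = fun x => x * x⁻¹ := by funext x; ring
    rw [this, cfc_mul _ _ _ (hc _) (hc _), hid]
  have hGHG : G * H * G = G := by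
    rw [hGH]
    conv_lhs => rhs; rw [← hid]
    rw [← cfc_mul _ _ _ (hc _) (hc _)]
    conv_rhs => rw [← hid]
    congr 1; funext x
    by_cases hx : x = 0 <;> simp [hx]
  have hHGH : H * G * H = H := by
    rw [hHG, hH, ← cfc_mul _ _ _ (hc _) (hc _)]
    congr 1; funext x
    by_cases hx : x = 0 <;> simp [hx]
  have hMHG : M * (H * G) = M := by
    have hz : (M * (H * G) - M).transpose * (M * (H * G) - M) = 0 := by
      have e1 : (M * (H * G)).transpose = G * H * M.transpose := by
        rw [Matrix.transpose_mul, Matrix.transpose_mul, hGt, hHs]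
      have e2 : G * H * M.transpose * (M * (H * G)) = G := by
        rw [Matrix.mul_assoc (G * H), ← Matrix.mul_assoc M.transpose, ← hG,
          ← Matrix.mul_assoc G H G, hGHG, hGHG]
      have e3 : G * H * M.transpose * M = G := by
        rw [Matrix.mul_assoc (G * H), ← hG, hGHG]
      have e4 : M.transpose * (M * (H * G)) = G := by
        rw [← Matrix.mul_assoc, ← hG, ← Matrix.mul_assoc, hGHG]
      rw [Matrix.transpose_sub, e1, Matrix.sub_mul, Matrix.mul_sub, Matrix.mul_sub, e2, e3, e4,
        ← hG]
      simp
    rw [← Matrix.conjTranspose_eq_transpose_of_trivial, Matrix.conjTranspose_mul_self_eq_zero] at hz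
    exact sub_eq_zero.mp hz
  refine ⟨H * M.transpose, ?_, ?_, ?_, ?_⟩
  · rw [Matrix.mul_assoc, Matrix.mul_assoc H, ← hG, hMHG]
  · rw [Matrix.mul_assoc H, ← hG, ← Matrix.mul_assoc, hHGH]
  · rw [Matrix.transpose_mul, Matrix.transpose_mul, Matrix.transpose_transpose, hHs,
      Matrix.mul_assoc]
  · rw [Matrix.mul_assoc H, ← hG, Matrix.transpose_mul, hHs, hGt, hHG, hGH]

/-- The Moore–Penrose pseudoinverse `M⁺`. -/
noncomputable def pinv {m n : ℕ} (M : Matrix (Fin m) (Fin n) ℝ) : Matrix (Fin n) (Fin m) ℝ :=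
  (exists_isMoorePenrose M).choose

theorem isMoorePenrose_pinv {m n : ℕ} (M : Matrix (Fin m) (Fin n) ℝ) :
    IsMoorePenrose M (pinv M) :=
  (exists_isMoorePenrose M).choose_spec

/-- The `i`-th rank-`k` column ridge leverage score
`τ_i^k(M) = a_iᵀ (M Mᵀ + (‖M - M_k‖_F² / k) I)⁺ a_i`, where `a_i` is the `i`-th column of `M`. -/
noncomputable def ridgeScore {m n : ℕ} (k : ℕ) (M : Matrix (Fin m) (Fin n) ℝ) (i : Fin n) : ℝ :=
  M.col i ⬝ᵥ
    (pinv (M * M.transpose + (tailSq M k / k) • (1 : Matrix (Fin m) (Fin m) ℝ))).mulVec (M.col i)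

/-- The weighted sampling matrix whose `j`-th column is `e_{s j} / √(t p_{s j})`. -/
noncomputable def samplingMatrix {n t : ℕ} (p : Fin n → ℝ) (s : Fin t → Fin n) :
    Matrix (Fin n) (Fin t) ℝ :=
  Matrix.of fun i j => if i = s j then 1 / √(t * p (s j)) else 0

/-- `P` is (the matrix of) an orthogonal projection of rank `k`. -/
def IsOrthProjOfRank {t : ℕ} (k : ℕ) (P : Matrix (Fin t) (Fin t) ℝ) : Prop :=
  P.transpose = P ∧ P * P = P ∧ P.rank = k

/-!
Write `T = ‖A - A_k‖_F²`, fix the threshold `a = √(ε T / (256 k))` on the eigenvalues of `A`, and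
let `Q` be the spectral projection onto the eigenvalues above `a`.

*Scores.* The rank-`k'` ridge parameter of `A^(1/2)` is `O(√(n T) / k')`. Oversampling by
`√(16 n ε / k)` divides it by the same factor, which brings it below `a` (`tailSq_sqrt_div_le`,
`ridgeRoot_diag_le`). So `l i` dominates the squared norm of the `i`-th row of
`B = (A (A + a)⁻¹)^(1/2)`.

*Random input.* For a sample `S` four facts hold with large probability. First,
`‖B (S Sᵀ - 1) B‖ ≤ ε / 16` (`sampleProb_quadForm_sampling_le`): this is a matrix Bernstein
inequality, obtained by the Ahlswede–Winter method from the Golden–Thompson inequality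
`trace_exp_add_le`, itself a consequence of `tr (P R)^(2^m) ≤ tr (P^(2^m) R^(2^m))` and of the
Lie–Trotter formula. The others are second-moment bounds: the cross term
`Q S Sᵀ (1 - Q) M` is small, the mass of `(1 - Q) A` is almost kept, and the mass of the doubly
sampled tail is at most `600 T`.

*Deterministic part.* The bound on `B` makes `S` an embedding of the range of `Q` with relative
error `ε / 8` and bounds the sampled tail in operator norm: both
`S₂ᵀ (1 - Q) A^(1/2)` and `(1 - Q) A^(1/2) S₁` have squared norm at most `4 a`, so
`S₂ᵀ (1 - Q) A S₁ P` has squared Frobenius norm at most `16 k a² = ε T / 16`. Up to such errors the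
cost of `P` on the tail equals the total mass of the tail, and the change of that mass is the shift
`Δ` (`abs_frobSq_sketch_add_sub_le`). All errors are of order `ε T` or `ε ‖A S₁ (1 - P)‖_F²`.
The same estimate, applied to `S₁` and `A` in place of `S₂` and `A S₁`, yields
`T ≤ 4 ‖A S₁ (1 - P)‖_F²` (`tailSq_le_four_mul_frobSq`), which turns the additive error into a
relative one.
-/

section
open Matrix

/-! ### Golden–Thompson -/

section
variable {n : Type*} [Fintype n]

theorem trace_mul_sq_le (X Y : Matrix n n ℝ) :
    (X * Y).trace ^ 2 ≤ (X * Xᵀ).trace * (Yᵀ * Y).trace := by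
  have h1 : (X * Y).trace = ∑ q : n × n, X q.1 q.2 * Y q.2 q.1 := by
    simp [Matrix.trace, Matrix.mul_apply, Fintype.sum_prod_type]
  have h2 : (X * Xᵀ).trace = ∑ q : n × n, X q.1 q.2 ^ 2 := by
    simp [Matrix.trace, Matrix.mul_apply, Fintype.sum_prod_type, sq]
  have h3 : (Yᵀ * Y).trace = ∑ q : n × n, Y q.2 q.1 ^ 2 := by
    simp [Matrix.trace, Matrix.mul_apply, Fintype.sum_prod_type, sq]
  rw [h1, h2, h3]
  exact Finset.sum_mul_sq_le_sq_mul_sq _ _ _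

variable [DecidableEq n]

theorem trace_mul_pow_comm (X Y : Matrix n n ℝ) (r : ℕ) :
    ((X * Y) ^ r).trace = ((Y * X) ^ r).trace := by
  rcases r with _ | r
  · simp
  · rw [pow_succ, ← Matrix.mul_assoc, Matrix.trace_mul_comm, ← Matrix.mul_assoc,
      ← mul_pow_mul, Matrix.mul_assoc, ← pow_succ]

/-- Two inequalities proved by a joint induction on `m`: the first gives Golden–Thompson in the
limit, the second bounds `tr M^(2r)` by `tr (MᵀM)^r`. Each reduces to the other one at smaller `m`,
since `(M²)ᵀM²` and `(PR)ᵀPR` are, up to a cyclic permutation, products of two symmetric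
matrices. -/
theorem trace_pow_two_pow_le (m : ℕ) :
    (∀ P R : Matrix n n ℝ, Pᵀ = P → Rᵀ = R →
      ((P * R) ^ 2 ^ m).trace ≤ (P ^ 2 ^ m * R ^ 2 ^ m).trace) ∧
    (∀ M : Matrix n n ℝ, (M ^ 2 ^ (m + 1)).trace ≤ ((Mᵀ * M) ^ 2 ^ m).trace) := by
  induction m using Nat.strong_induction_on with
  | _ m ih =>
  -- Cauchy–Schwarz, as `MᵀM` and `MMᵀ` have the same trace powers.
  have key : ∀ M : Matrix n n ℝ, ∀ j,
      (((Mᵀ * M) ^ 2 ^ j) * ((M * Mᵀ) ^ 2 ^ j)).trace ≤ ((Mᵀ * M) ^ 2 ^ (j + 1)).trace := by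
    intro M j
    have h := trace_mul_sq_le ((Mᵀ * M) ^ 2 ^ j) ((M * Mᵀ) ^ 2 ^ j)
    have e : ((M * Mᵀ) ^ 2 ^ (j + 1)).trace = ((Mᵀ * M) ^ 2 ^ (j + 1)).trace :=
      trace_mul_pow_comm _ _ _
    simp only [Matrix.transpose_pow, Matrix.transpose_mul, Matrix.transpose_transpose,
      ← pow_two, ← pow_mul, ← pow_succ] at h
    rw [e] at h
    have h0 : 0 ≤ ((Mᵀ * M) ^ 2 ^ (j + 1)).trace := by
      have : ((Mᵀ * M) ^ 2 ^ (j + 1)).trace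
          = (((Mᵀ * M) ^ 2 ^ j) * ((Mᵀ * M) ^ 2 ^ j)ᵀ).trace := by
        simp only [Matrix.transpose_pow, Matrix.transpose_mul, Matrix.transpose_transpose,
          ← pow_two, ← pow_mul, ← pow_succ]
      rw [this]
      simp only [Matrix.trace, Matrix.mul_apply, Matrix.transpose_apply, Matrix.diag]
      exact Finset.sum_nonneg fun i _ => Finset.sum_nonneg fun k _ => mul_self_nonneg _
    rw [← pow_two] at h
    exact (le_abs_self _).trans (abs_le_of_sq_le_sq h h0)
  have hW : ∀ M : Matrix n n ℝ, (M ^ 2 ^ (m + 1)).trace ≤ ((Mᵀ * M) ^ 2 ^ m).trace := by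
    intro M
    rcases m with _ | m
    · have h := trace_mul_sq_le M M
      rw [Matrix.trace_mul_comm M Mᵀ, ← pow_two, ← pow_two] at h
      have h0 : 0 ≤ (Mᵀ * M).trace := by
        simp only [Matrix.trace, Matrix.mul_apply, Matrix.transpose_apply, Matrix.diag]
        exact Finset.sum_nonneg fun i _ => Finset.sum_nonneg fun k _ => mul_self_nonneg _
      simpa using (le_abs_self _).trans (abs_le_of_sq_le_sq h h0)
    · calc (M ^ 2 ^ (m + 1 + 1)).trace = ((M ^ 2) ^ 2 ^ (m + 1)).trace := by
            rw [← pow_mul, ← pow_succ']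
        _ ≤ (((M ^ 2)ᵀ * M ^ 2) ^ 2 ^ m).trace := (ih m (Nat.lt_succ_self m)).2 _
        _ = ((Mᵀ * ((Mᵀ * M) * M)) ^ 2 ^ m).trace := by
            rw [pow_two, Matrix.transpose_mul]; simp only [Matrix.mul_assoc]
        _ = (((Mᵀ * M) * (M * Mᵀ)) ^ 2 ^ m).trace := by
            rw [trace_mul_pow_comm]; simp only [Matrix.mul_assoc]
        _ ≤ (((Mᵀ * M) ^ 2 ^ m) * ((M * Mᵀ) ^ 2 ^ m)).trace :=
            (ih m (Nat.lt_succ_self m)).1 _ _ (by simp) (by simp)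
        _ ≤ _ := key M m
  refine ⟨?_, hW⟩
  intro P R hP hR
  rcases m with _ | m
  · simp
  · calc ((P * R) ^ 2 ^ (m + 1)).trace ≤ (((P * R)ᵀ * (P * R)) ^ 2 ^ m).trace :=
          (ih m (Nat.lt_succ_self m)).2 _
      _ = ((R * (P ^ 2 * R)) ^ 2 ^ m).trace := by
          rw [Matrix.transpose_mul, hP, hR, pow_two]; simp only [Matrix.mul_assoc]
      _ = ((P ^ 2 * R ^ 2) ^ 2 ^ m).trace := by
          rw [trace_mul_pow_comm, pow_two R]; simp only [Matrix.mul_assoc]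
      _ ≤ ((P ^ 2) ^ 2 ^ m * (R ^ 2) ^ 2 ^ m).trace :=
          (ih m (Nat.lt_succ_self m)).1 _ _ (by rw [Matrix.transpose_pow, hP])
            (by rw [Matrix.transpose_pow, hR])
      _ = _ := by rw [← pow_mul, ← pow_mul, ← pow_succ']

end

section
open Filter Topology NormedSpace

theorem norm_exp_le_exp_norm {𝔸 : Type*} [NormedRing 𝔸] [NormOneClass 𝔸] [NormedAlgebra ℝ 𝔸]
    [CompleteSpace 𝔸] (a : 𝔸) : ‖NormedSpace.exp a‖ ≤ Real.exp ‖a‖ := by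
  rw [NormedSpace.exp_eq_tsum ℝ, Real.exp_eq_exp_ℝ, NormedSpace.exp_eq_tsum ℝ]
  refine (norm_tsum_le_tsum_norm (NormedSpace.norm_expSeries_summable' (𝕂 := ℝ) a)).trans ?_
  refine Summable.tsum_le_tsum (fun k => ?_) (NormedSpace.norm_expSeries_summable' (𝕂 := ℝ) a)
    (NormedSpace.expSeries_summable' (𝕂 := ℝ) ‖a‖)
  rw [norm_smul, smul_eq_mul, Real.norm_of_nonneg (by positivity)]
  gcongr
  exact norm_pow_le a k

theorem norm_pow_sub_pow_le {𝔸 : Type*} [NormedRing 𝔸] [NormOneClass 𝔸] {x y : 𝔸} {r : ℝ}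
    (hx : ‖x‖ ≤ r) (hy : ‖y‖ ≤ r) (N : ℕ) : ‖x ^ N - y ^ N‖ ≤ N * r ^ (N - 1) * ‖x - y‖ := by
  have hr : 0 ≤ r := (norm_nonneg x).trans hx
  induction N with
  | zero => simp
  | succ N ih =>
    have e : x ^ (N + 1) - y ^ (N + 1) = (x ^ N - y ^ N) * x + y ^ N * (x - y) := by
      rw [pow_succ, pow_succ]; noncomm_ring
    rw [e]
    refine (norm_add_le _ _).trans ?_
    have h1 : ‖(x ^ N - y ^ N) * x‖ ≤ N * r ^ N * ‖x - y‖ := by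
      refine (norm_mul_le _ _).trans ?_
      refine (mul_le_mul ih hx (norm_nonneg _) (by positivity)).trans (le_of_eq ?_)
      rcases N with _ | N
      · simp
      · simp only [Nat.add_sub_cancel, pow_succ]; ring
    have h2 : ‖y ^ N * (x - y)‖ ≤ r ^ N * ‖x - y‖ := by
      refine (norm_mul_le _ _).trans ?_
      gcongr
      exact (norm_pow_le y N).trans (by gcongr)
    simp only [Nat.add_sub_cancel]
    push_cast
    nlinarith [h1, h2]

/-- The Lie–Trotter product formula. -/
theorem tendsto_exp_mul_exp_pow {𝔸 : Type*} [NormedRing 𝔸] [NormOneClass 𝔸] [NormedAlgebra ℝ 𝔸]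
    [CompleteSpace 𝔸] (a b : 𝔸) :
    Tendsto (fun N : ℕ => (exp ((N : ℝ)⁻¹ • a) * exp ((N : ℝ)⁻¹ • b)) ^ N) atTop
      (𝓝 (exp (a + b))) := by
  let : NormedAlgebra ℚ 𝔸 := NormedAlgebra.restrictScalars ℚ ℝ 𝔸
  -- Both factors agree with `exp (s • (a + b))` to first order, so the error per step is `o(1/N)`.
  have hd : HasDerivAt (fun s : ℝ => exp (s • a) * exp (s • b) - exp (s • (a + b)))
      0 (0 : ℝ) := by
    have h1 := (hasDerivAt_exp_smul_const (𝕂 := ℝ) a (0 : ℝ)).mul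
      (hasDerivAt_exp_smul_const (𝕂 := ℝ) b (0 : ℝ))
    have h2 := h1.sub (hasDerivAt_exp_smul_const (𝕂 := ℝ) (a + b) (0 : ℝ))
    refine h2.congr_deriv ?_
    simp [exp_zero]
  have hlim : Tendsto (fun N : ℕ => (N : ℝ) *
      ‖exp ((N : ℝ)⁻¹ • a) * exp ((N : ℝ)⁻¹ • b) - exp ((N : ℝ)⁻¹ • (a + b))‖) atTop (𝓝 0) := by
    have h1 := hasDerivAt_iff_tendsto.mp hd
    have h2 : Tendsto (fun N : ℕ => ((N : ℝ))⁻¹) atTop (𝓝 0) := tendsto_inv_atTop_nhds_zero_nat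
    refine (h1.comp h2).congr fun N => ?_
    simp [exp_zero]
  rw [tendsto_iff_norm_sub_tendsto_zero]
  set c := ‖a‖ + ‖b‖
  have hlim2 := hlim.const_mul (Real.exp c)
  rw [mul_zero] at hlim2
  refine squeeze_zero' (Eventually.of_forall fun _ => norm_nonneg _) ?_ hlim2
  filter_upwards [eventually_gt_atTop 0] with N hN
  have hN' : (0 : ℝ) < N := by exact_mod_cast hN
  have e : exp (a + b) = exp ((N : ℝ)⁻¹ • (a + b)) ^ N := by
    rw [← NormedSpace.exp_nsmul, ← Nat.cast_smul_eq_nsmul ℝ, smul_smul, mul_inv_cancel₀ hN'.ne', one_smul]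
  rw [e]
  have hx : ‖exp ((N : ℝ)⁻¹ • a) * exp ((N : ℝ)⁻¹ • b)‖ ≤ Real.exp (c / N) := by
    refine (norm_mul_le _ _).trans ?_
    refine (mul_le_mul (norm_exp_le_exp_norm _) (norm_exp_le_exp_norm _) (norm_nonneg _)
      (Real.exp_pos _).le).trans (le_of_eq ?_)
    rw [← Real.exp_add, norm_smul, norm_smul, norm_inv, Real.norm_natCast]
    congr 1; simp only [c]; ring
  have hy : ‖exp ((N : ℝ)⁻¹ • (a + b))‖ ≤ Real.exp (c / N) := by
    refine (norm_exp_le_exp_norm _).trans (Real.exp_le_exp.mpr ?_)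
    rw [norm_smul, norm_inv, Real.norm_natCast, div_eq_inv_mul]
    gcongr
    exact norm_add_le a b
  refine (norm_pow_sub_pow_le hx hy N).trans ?_
  have hexp : Real.exp (c / N) ^ (N - 1) ≤ Real.exp c := by
    rw [← Real.exp_nat_mul]
    apply Real.exp_le_exp.mpr
    have : ((N - 1 : ℕ) : ℝ) ≤ N := by exact_mod_cast Nat.sub_le N 1
    calc ((N - 1 : ℕ) : ℝ) * (c / N) ≤ N * (c / N) := by gcongr
      _ = c := by field_simp
  calc _ = Real.exp (c / N) ^ (N - 1) * (N * ‖exp ((N : ℝ)⁻¹ • a) * exp ((N : ℝ)⁻¹ • b)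
        - exp ((N : ℝ)⁻¹ • (a + b))‖) := by ring
    _ ≤ _ := by gcongr

open scoped Matrix.Norms.Operator in
/-- The Golden–Thompson inequality for real symmetric matrices. -/
theorem trace_exp_add_le {n : Type*} [Fintype n] [DecidableEq n] {H Y : Matrix n n ℝ}
    (hH : Hᵀ = H) (hY : Yᵀ = Y) :
    (exp (H + Y)).trace ≤ (exp H * exp Y).trace := by
  cases isEmpty_or_nonempty n
  · simp [Matrix.trace]
  have h1 := tendsto_exp_mul_exp_pow H Y
  have h2 : Tendsto (fun m : ℕ => 2 ^ m) atTop (atTop : Filter ℕ) :=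
    tendsto_pow_atTop_atTop_of_one_lt one_lt_two
  have hc : Continuous fun M : Matrix n n ℝ => M.trace := by fun_prop
  refine le_of_tendsto (hc.continuousAt.tendsto.comp (h1.comp h2)) (Eventually.of_forall fun m => ?_)
  have hpos : ((2 ^ m : ℕ) : ℝ) ≠ 0 := by positivity
  have hpow : ∀ a : Matrix n n ℝ, exp (((2 ^ m : ℕ) : ℝ)⁻¹ • a) ^ 2 ^ m = exp a := fun a => by
    rw [← Matrix.exp_nsmul, ← Nat.cast_smul_eq_nsmul ℝ, smul_smul, mul_inv_cancel₀ hpos, one_smul]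
  have := (trace_pow_two_pow_le m).1 (exp (((2 ^ m : ℕ) : ℝ)⁻¹ • H)) (exp (((2 ^ m : ℕ) : ℝ)⁻¹ • Y))
    (by rw [← Matrix.exp_transpose, Matrix.transpose_smul, hH])
    (by rw [← Matrix.exp_transpose, Matrix.transpose_smul, hY])
  rw [hpow, hpow] at this
  exact this
end

/-! ### Independent samples from a finite distribution -/

/-- The expectation of `f` over `t` independent draws from the weights `p` on a finite type, as a
finite sum. -/
noncomputable def sampleExp {α : Type*} [Fintype α] (p : α → ℝ) (t : ℕ)
    (f : (Fin t → α) → ℝ) : ℝ :=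
  ∑ s : Fin t → α, (∏ j, p (s j)) * f s

section
variable {α : Type*} [Fintype α] {p : α → ℝ}

theorem sampleExp_zero (f : (Fin 0 → α) → ℝ) : sampleExp p 0 f = f Fin.elim0 := by
  have : (default : Fin 0 → α) = Fin.elim0 := Subsingleton.elim _ _
  simp [sampleExp, this]

theorem sampleExp_succ (t : ℕ) (f : (Fin (t + 1) → α) → ℝ) :
    sampleExp p (t + 1) f = ∑ i, p i * sampleExp p t fun s => f (Fin.cons i s) := by
  unfold sampleExp
  rw [← (Fin.consEquiv fun _ => α).sum_comp, Fintype.sum_prod_type]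
  refine Finset.sum_congr rfl fun i _ => ?_
  rw [Finset.mul_sum]
  refine Finset.sum_congr rfl fun s _ => ?_
  have e : (Fin.consEquiv fun _ => α) (i, s) = Fin.cons i s := rfl
  simp only [e, Fin.prod_univ_succ, Fin.cons_zero, Fin.cons_succ]
  ring

theorem sampleExp_add (t : ℕ) (f g : (Fin t → α) → ℝ) :
    sampleExp p t (fun s => f s + g s) = sampleExp p t f + sampleExp p t g := by
  simp [sampleExp, mul_add, Finset.sum_add_distrib]

theorem sampleExp_const_mul (t : ℕ) (c : ℝ) (f : (Fin t → α) → ℝ) :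
    sampleExp p t (fun s => c * f s) = c * sampleExp p t f := by
  simp only [sampleExp, Finset.mul_sum]
  exact Finset.sum_congr rfl fun _ _ => by ring

theorem sampleExp_sum {β : Type*} (u : Finset β) (t : ℕ) (f : β → (Fin t → α) → ℝ) :
    sampleExp p t (fun s => ∑ b ∈ u, f b s) = ∑ b ∈ u, sampleExp p t (f b) := by
  simp only [sampleExp, Finset.mul_sum]
  exact Finset.sum_comm

theorem sampleExp_const (h1 : ∑ i, p i = 1) (t : ℕ) (c : ℝ) :
    sampleExp p t (fun _ => c) = c := by
  induction t with
  | zero => rw [sampleExp_zero]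
  | succ t ih => rw [sampleExp_succ]; simp [ih, ← Finset.sum_mul, h1]

theorem sampleExp_mono (h0 : ∀ i, 0 ≤ p i) {t : ℕ} {f g : (Fin t → α) → ℝ}
    (h : ∀ s, f s ≤ g s) : sampleExp p t f ≤ sampleExp p t g :=
  Finset.sum_le_sum fun s _ => mul_le_mul_of_nonneg_left (h s)
    (Finset.prod_nonneg fun _ _ => h0 _)

theorem sampleExp_nonneg (h0 : ∀ i, 0 ≤ p i) {t : ℕ} {f : (Fin t → α) → ℝ}
    (h : ∀ s, 0 ≤ f s) : 0 ≤ sampleExp p t f :=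
  Finset.sum_nonneg fun s _ => mul_nonneg (Finset.prod_nonneg fun _ _ => h0 _) (h s)

theorem sampleExp_sum_apply (h1 : ∑ i, p i = 1) (t : ℕ) (y : α → ℝ) :
    sampleExp p t (fun s => ∑ j, y (s j)) = t * ∑ i, p i * y i := by
  induction t with
  | zero => simp [sampleExp_zero]
  | succ t ih =>
    rw [sampleExp_succ]
    simp only [Fin.sum_univ_succ, Fin.cons_zero, Fin.cons_succ, sampleExp_add,
      sampleExp_const h1, ih, mul_add, Finset.sum_add_distrib, ← Finset.sum_mul, h1]
    push_cast
    ring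

/-- The second moment of a sum of independent centred variables is the sum of the second moments. -/
theorem sampleExp_sum_sq_of_centered (h1 : ∑ i, p i = 1) (t : ℕ) (y : α → ℝ)
    (hy : ∑ i, p i * y i = 0) :
    sampleExp p t (fun s => (∑ j, y (s j)) ^ 2) = t * ∑ i, p i * y i ^ 2 := by
  induction t with
  | zero => simp [sampleExp_zero]
  | succ t ih =>
    rw [sampleExp_succ]
    have e : ∀ i, sampleExp p t (fun s => (∑ j, y ((Fin.cons i s : Fin (t + 1) → α) j)) ^ 2)
        = y i ^ 2 + t * ∑ i, p i * y i ^ 2 := by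
      intro i
      simp only [Fin.sum_univ_succ, Fin.cons_zero, Fin.cons_succ, add_sq, sampleExp_add,
        sampleExp_const h1, ih, sampleExp_const_mul, sampleExp_sum_apply h1, hy]
      ring
    simp only [e, mul_add, Finset.sum_add_distrib, ← Finset.sum_mul, h1]
    push_cast
    ring

theorem sampleExp_sum_sub_sq_le (h1 : ∑ i, p i = 1) (t : ℕ) (z : α → ℝ) :
    sampleExp p t (fun s => (∑ j, z (s j) - t * ∑ i, p i * z i) ^ 2)
      ≤ t * ∑ i, p i * z i ^ 2 := by
  set m := ∑ i, p i * z i with hm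
  have hc : ∑ i, p i * (z i - m) = 0 := by
    simp only [mul_sub, Finset.sum_sub_distrib, ← Finset.sum_mul, h1, ← hm]; ring
  have h := sampleExp_sum_sq_of_centered h1 t (fun i => z i - m) hc
  simp only [Finset.sum_sub_distrib, Finset.sum_const, Finset.card_univ, Fintype.card_fin,
    nsmul_eq_mul] at h
  rw [h]
  have e : ∑ i, p i * (z i - m) ^ 2 = ∑ i, p i * z i ^ 2 - m ^ 2 := by
    have : ∀ i, p i * (z i - m) ^ 2 = p i * z i ^ 2 - 2 * m * (p i * z i) + p i * m ^ 2 :=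
      fun i => by ring
    simp only [this, Finset.sum_add_distrib, Finset.sum_sub_distrib, ← Finset.mul_sum,
      ← Finset.sum_mul, h1, ← hm]
    ring
  rw [e]
  gcongr
  nlinarith [sq_nonneg m]

end

/-! ### Diagonalization of symmetric matrices -/

/-- The matrix `U diag(d) Uᵀ`, with eigenvalues `d` on the columns of an orthogonal matrix `U`. -/
noncomputable def conjDiag {n : Type*} [Fintype n] [DecidableEq n] (U : Matrix n n ℝ) (d : n → ℝ) :
    Matrix n n ℝ :=
  U * diagonal d * Uᵀ

section
variable {n : Type*} [Fintype n] [DecidableEq n] {U : Matrix n n ℝ}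

theorem exists_eq_conjDiag {A : Matrix n n ℝ} (hA : Aᵀ = A) :
    ∃ (U : Matrix n n ℝ) (d : n → ℝ), Uᵀ * U = 1 ∧ A = conjDiag U d := by
  have hH : A.IsHermitian := by
    rw [Matrix.IsHermitian, Matrix.conjTranspose_eq_transpose_of_trivial, hA]
  refine ⟨hH.eigenvectorUnitary, hH.eigenvalues, ?_, ?_⟩
  · have := Unitary.coe_star_mul_self hH.eigenvectorUnitary
    rwa [Matrix.star_eq_conjTranspose, Matrix.conjTranspose_eq_transpose_of_trivial] at this
  · have := hH.spectral_theorem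
    rw [Unitary.conjStarAlgAut_apply, Matrix.star_eq_conjTranspose,
      Matrix.conjTranspose_eq_transpose_of_trivial] at this
    exact this

theorem conjDiag_transpose (d : n → ℝ) : (conjDiag U d)ᵀ = conjDiag U d := by
  simp [conjDiag, Matrix.mul_assoc]

theorem conjDiag_mul (hU : Uᵀ * U = 1) (d e : n → ℝ) :
    conjDiag U d * conjDiag U e = conjDiag U (fun j => d j * e j) := by
  unfold conjDiag
  calc U * diagonal d * Uᵀ * (U * diagonal e * Uᵀ)
      = U * diagonal d * (Uᵀ * U) * diagonal e * Uᵀ := by simp only [Matrix.mul_assoc]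
    _ = _ := by rw [hU, Matrix.mul_one, Matrix.mul_assoc U, Matrix.diagonal_mul_diagonal]

theorem conjDiag_one (hU : Uᵀ * U = 1) : conjDiag U (fun _ => 1) = 1 := by
  simp [conjDiag, mul_eq_one_comm.mp hU]

theorem conjDiag_add (d e : n → ℝ) :
    conjDiag U d + conjDiag U e = conjDiag U (fun j => d j + e j) := by
  simp only [conjDiag, ← Matrix.add_mul, ← Matrix.mul_add, Matrix.diagonal_add]

theorem conjDiag_sub (d e : n → ℝ) :
    conjDiag U d - conjDiag U e = conjDiag U (fun j => d j - e j) := by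
  simp only [conjDiag, ← Matrix.sub_mul, ← Matrix.mul_sub, Matrix.diagonal_sub]

theorem conjDiag_smul (c : ℝ) (d : n → ℝ) :
    c • conjDiag U d = conjDiag U (fun j => c * d j) := by
  have : (diagonal fun j => c * d j) = c • diagonal d := by
    ext i j; simp [Matrix.diagonal_apply]
  simp only [conjDiag, this, Matrix.mul_smul, Matrix.smul_mul]

theorem trace_conjDiag (hU : Uᵀ * U = 1) (d : n → ℝ) : (conjDiag U d).trace = ∑ j, d j := by
  rw [conjDiag, Matrix.trace_mul_comm, ← Matrix.mul_assoc, hU, Matrix.one_mul,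
    Matrix.trace_diagonal]

theorem trace_conjDiag_mul (d : n → ℝ) (G : Matrix n n ℝ) :
    (conjDiag U d * G).trace = ∑ j, d j * (U.col j ⬝ᵥ G *ᵥ U.col j) := by
  have : (conjDiag U d * G).trace = (diagonal d * (Uᵀ * G * U)).trace := by
    rw [conjDiag, Matrix.mul_assoc, Matrix.mul_assoc, Matrix.trace_mul_comm]
    simp only [Matrix.mul_assoc]
  rw [this]
  simp only [Matrix.trace, Matrix.diag, Matrix.diagonal_mul]
  refine Finset.sum_congr rfl fun j _ => ?_
  congr 1
  rw [Matrix.mul_assoc]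
  rfl

theorem dotProduct_conjDiag_mulVec (d : n → ℝ) (v : n → ℝ) :
    v ⬝ᵥ conjDiag U d *ᵥ v = ∑ j, d j * (Uᵀ *ᵥ v) j ^ 2 := by
  rw [conjDiag, ← Matrix.mulVec_mulVec, ← Matrix.mulVec_mulVec, Matrix.dotProduct_mulVec,
    ← Matrix.mulVec_transpose]
  simp only [dotProduct, Matrix.mulVec_diagonal]
  exact Finset.sum_congr rfl fun j _ => by ring

theorem conjDiag_diag (d : n → ℝ) (i : n) : conjDiag U d i i = ∑ j, d j * U i j ^ 2 := by
  rw [conjDiag, Matrix.mul_apply]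
  simp only [Matrix.mul_diagonal, Matrix.transpose_apply]
  exact Finset.sum_congr rfl fun j _ => by ring

theorem dotProduct_self_eq_sum (hU : Uᵀ * U = 1) (v : n → ℝ) :
    v ⬝ᵥ v = ∑ j, (Uᵀ *ᵥ v) j ^ 2 := by
  have := dotProduct_conjDiag_mulVec (U := U) (fun _ => 1) v
  rw [conjDiag_one hU] at this
  simpa using this

theorem dotProduct_conjDiag_mulVec_le (hU : Uᵀ * U = 1) {d : n → ℝ} {c : ℝ} (h : ∀ j, d j ≤ c)
    (v : n → ℝ) : v ⬝ᵥ conjDiag U d *ᵥ v ≤ c * (v ⬝ᵥ v) := by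
  rw [dotProduct_conjDiag_mulVec, dotProduct_self_eq_sum hU, Finset.mul_sum]
  exact Finset.sum_le_sum fun j _ => mul_le_mul_of_nonneg_right (h j) (sq_nonneg _)

theorem dotProduct_col_self (hU : Uᵀ * U = 1) (j : n) : U.col j ⬝ᵥ U.col j = 1 := by
  have := congrFun (congrFun hU j) j
  rw [Matrix.one_apply_eq] at this
  rw [← this]; rfl

theorem col_dotProduct_conjDiag (hU : Uᵀ * U = 1) (d : n → ℝ) (j : n) :
    U.col j ⬝ᵥ conjDiag U d *ᵥ U.col j = d j := by
  rw [dotProduct_conjDiag_mulVec]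
  have : ∀ i, (Uᵀ *ᵥ U.col j) i = (1 : Matrix n n ℝ) i j := fun i => by rw [← hU]; rfl
  simp [this, Matrix.one_apply]

theorem exp_conjDiag (hU : Uᵀ * U = 1) (d : n → ℝ) :
    NormedSpace.exp (conjDiag U d) = conjDiag U (fun j => Real.exp (d j)) := by
  have hinv : U⁻¹ = Uᵀ := Matrix.inv_eq_left_inv hU
  have hunit : IsUnit U := by
    rw [Matrix.isUnit_iff_isUnit_det]
    exact Matrix.isUnit_det_of_left_inverse hU
  have := Matrix.exp_conj U (diagonal d) hunit
  rw [hinv, Matrix.exp_diagonal] at this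
  rw [conjDiag, this, conjDiag]
  congr 3
  funext j
  rw [Pi.coe_exp, Real.exp_eq_exp_ℝ]

/-! ### The matrix Bernstein inequality -/

theorem trace_exp_mul_le {H G : Matrix n n ℝ} (hH : Hᵀ = H) {g : ℝ}
    (hG : ∀ v : n → ℝ, v ⬝ᵥ G *ᵥ v ≤ g * (v ⬝ᵥ v)) :
    (NormedSpace.exp H * G).trace ≤ g * (NormedSpace.exp H).trace := by
  obtain ⟨U, d, hU, rfl⟩ := exists_eq_conjDiag hH
  rw [exp_conjDiag hU, trace_conjDiag_mul, trace_conjDiag hU, Finset.mul_sum]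
  refine Finset.sum_le_sum fun j _ => ?_
  have := hG (U.col j)
  rw [dotProduct_col_self hU] at this
  nlinarith [Real.exp_pos (d j)]

/-- The scalar bound `exp x ≤ 1 + x + x ^ 2` for `|x| ≤ 1`, on the spectrum of `Y`. -/
theorem dotProduct_exp_mulVec_le {Y : Matrix n n ℝ} (hY : Yᵀ = Y)
    (h1 : ∀ v : n → ℝ, |v ⬝ᵥ Y *ᵥ v| ≤ v ⬝ᵥ v) (v : n → ℝ) :
    v ⬝ᵥ NormedSpace.exp Y *ᵥ v ≤ v ⬝ᵥ v + v ⬝ᵥ Y *ᵥ v + v ⬝ᵥ (Y * Y) *ᵥ v := by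
  obtain ⟨U, d, hU, rfl⟩ := exists_eq_conjDiag hY
  rw [exp_conjDiag hU, conjDiag_mul hU, dotProduct_conjDiag_mulVec, dotProduct_conjDiag_mulVec,
    dotProduct_conjDiag_mulVec, dotProduct_self_eq_sum hU, ← Finset.sum_add_distrib,
    ← Finset.sum_add_distrib]
  refine Finset.sum_le_sum fun j _ => ?_
  have hd := h1 (U.col j)
  rw [col_dotProduct_conjDiag hU, dotProduct_col_self hU] at hd
  have := abs_le.mp (Real.abs_exp_sub_one_sub_id_le hd)
  nlinarith [sq_nonneg ((Uᵀ *ᵥ v) j)]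

/-- If some eigenvalue of `Y` exceeds `a`, then `exp a` is at most the trace of `exp Y`. -/
theorem exp_le_trace_exp {Y : Matrix n n ℝ} (hY : Yᵀ = Y) {a : ℝ}
    (h : ∃ v : n → ℝ, a * (v ⬝ᵥ v) < v ⬝ᵥ Y *ᵥ v) :
    Real.exp a ≤ (NormedSpace.exp Y).trace := by
  obtain ⟨U, d, hU, rfl⟩ := exists_eq_conjDiag hY
  obtain ⟨v, hv⟩ := h
  obtain ⟨j, hj⟩ : ∃ j, a < d j := by
    by_contra! hcon
    exact absurd (dotProduct_conjDiag_mulVec_le hU hcon v) (not_le.mpr hv)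
  rw [exp_conjDiag hU, trace_conjDiag hU]
  exact (Real.exp_le_exp.mpr hj.le).trans
    (Finset.single_le_sum (f := fun j => Real.exp (d j)) (fun _ _ => (Real.exp_pos _).le)
      (Finset.mem_univ j))

variable {α : Type*} [Fintype α] {p : α → ℝ}

/-- Each independent summand enters through Golden–Thompson and multiplies the expected trace of the
exponential by at most the top eigenvalue `1 + r` of its mean exponential. -/
theorem sampleExp_trace_exp_le (h0 : ∀ i, 0 ≤ p i) (h1 : ∑ i, p i = 1) {Y : α → Matrix n n ℝ}
    (hY : ∀ i, (Y i)ᵀ = Y i) (hb : ∀ i, ∀ v : n → ℝ, |v ⬝ᵥ Y i *ᵥ v| ≤ v ⬝ᵥ v)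
    (hm : ∑ i, p i • Y i = 0) {r : ℝ} (hr : 0 ≤ r)
    (hv : ∀ v : n → ℝ, ∑ i, p i * (v ⬝ᵥ (Y i * Y i) *ᵥ v) ≤ r * (v ⬝ᵥ v)) (t : ℕ) :
    sampleExp p t (fun s => (NormedSpace.exp (∑ j, Y (s j))).trace)
      ≤ (1 + r) ^ t * Fintype.card n := by
  induction t with
  | zero => simp [sampleExp_zero, NormedSpace.exp_zero]
  | succ t ih =>
    have hG : ∀ v : n → ℝ, v ⬝ᵥ (∑ i, p i • NormedSpace.exp (Y i)) *ᵥ v ≤ (1 + r) * (v ⬝ᵥ v) := by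
      intro v
      have hm' : ∑ i, p i * (v ⬝ᵥ Y i *ᵥ v) = 0 := by
        have := congrArg (fun M : Matrix n n ℝ => v ⬝ᵥ M *ᵥ v) hm
        simpa [Matrix.sum_mulVec, dotProduct_sum, Matrix.smul_mulVec, dotProduct_smul] using this
      calc v ⬝ᵥ (∑ i, p i • NormedSpace.exp (Y i)) *ᵥ v
          = ∑ i, p i * (v ⬝ᵥ NormedSpace.exp (Y i) *ᵥ v) := by
            simp [Matrix.sum_mulVec, dotProduct_sum, Matrix.smul_mulVec, dotProduct_smul]
        _ ≤ ∑ i, p i * (v ⬝ᵥ v + v ⬝ᵥ Y i *ᵥ v + v ⬝ᵥ (Y i * Y i) *ᵥ v) :=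
            Finset.sum_le_sum fun i _ => mul_le_mul_of_nonneg_left
              (dotProduct_exp_mulVec_le (hY i) (hb i) v) (h0 i)
        _ = v ⬝ᵥ v + ∑ i, p i * (v ⬝ᵥ (Y i * Y i) *ᵥ v) := by
            simp only [mul_add, Finset.sum_add_distrib, hm', ← Finset.sum_mul, h1]; ring
        _ ≤ _ := by linarith [hv v]
    rw [sampleExp_succ]
    calc ∑ i, p i * sampleExp p t
          (fun s => (NormedSpace.exp (∑ j, Y ((Fin.cons i s : Fin (t + 1) → α) j))).trace)
        ≤ ∑ i, p i * sampleExp p t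
          (fun s => (NormedSpace.exp (∑ j, Y (s j)) * NormedSpace.exp (Y i)).trace) := by
          refine Finset.sum_le_sum fun i _ => mul_le_mul_of_nonneg_left ?_ (h0 i)
          refine sampleExp_mono h0 fun s => ?_
          rw [Fin.sum_univ_succ, add_comm]
          simp only [Fin.cons_zero, Fin.cons_succ]
          exact trace_exp_add_le (by simp [Matrix.transpose_sum, hY]) (hY i)
      _ = sampleExp p t (fun s => (NormedSpace.exp (∑ j, Y (s j)) *
            ∑ i, p i • NormedSpace.exp (Y i)).trace) := by
          simp only [Matrix.mul_sum, Matrix.trace_sum, sampleExp_sum, Matrix.mul_smul,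
            Matrix.trace_smul, smul_eq_mul, sampleExp_const_mul]
      _ ≤ sampleExp p t (fun s => (1 + r) * (NormedSpace.exp (∑ j, Y (s j))).trace) :=
          sampleExp_mono h0 fun s => trace_exp_mul_le (by simp [Matrix.transpose_sum, hY]) hG
      _ ≤ (1 + r) * ((1 + r) ^ t * Fintype.card n) := by
          rw [sampleExp_const_mul]; gcongr
      _ = _ := by ring

end

section
variable {α : Type*} [Fintype α] {p : α → ℝ}

open Classical in
/-- The probability of the event `E` under `t` independent draws from `p`. -/
noncomputable def sampleProb (p : α → ℝ) (t : ℕ) (E : (Fin t → α) → Prop) : ℝ :=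
  sampleExp p t fun s => if E s then 1 else 0

open Classical in
/-- Markov's inequality. -/
theorem sampleProb_le_of_sampleExp_le (h0 : ∀ i, 0 ≤ p i) {t : ℕ} {f : (Fin t → α) → ℝ}
    (hf : ∀ s, 0 ≤ f s) {m c : ℝ} (hc : 0 < c) (hm : sampleExp p t f ≤ m) :
    sampleProb p t (fun s => c ≤ f s) ≤ m / c := by
  rw [le_div_iff₀ hc, mul_comm, sampleProb, ← sampleExp_const_mul]
  refine (sampleExp_mono h0 fun s => ?_).trans hm
  split_ifs with h
  · simpa using h
  · simpa using hf s

theorem sampleProb_mono (h0 : ∀ i, 0 ≤ p i) {t : ℕ} {E F : (Fin t → α) → Prop}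
    (h : ∀ s, E s → F s) : sampleProb p t E ≤ sampleProb p t F := by
  refine sampleExp_mono h0 fun s => ?_
  by_cases hE : E s
  · simp [hE, h s hE]
  · simp only [hE, if_false]; positivity

theorem sampleProb_or_le (h0 : ∀ i, 0 ≤ p i) {t : ℕ} (E F : (Fin t → α) → Prop) :
    sampleProb p t (fun s => E s ∨ F s) ≤ sampleProb p t E + sampleProb p t F := by
  rw [sampleProb, sampleProb, sampleProb, ← sampleExp_add]
  refine sampleExp_mono h0 fun s => ?_
  by_cases hE : E s <;> by_cases hF : F s <;> simp [hE, hF]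

/-- Upper tail of a sum of independent centred symmetric matrices with norm at most `1` and
variance at most `r`. -/
theorem sampleProb_exists_lt_quadForm_le {n : Type*} [Fintype n] [DecidableEq n]
    (h0 : ∀ i, 0 ≤ p i) (h1 : ∑ i, p i = 1) {Y : α → Matrix n n ℝ}
    (hY : ∀ i, (Y i)ᵀ = Y i) (hb : ∀ i, ∀ v : n → ℝ, |v ⬝ᵥ Y i *ᵥ v| ≤ v ⬝ᵥ v)
    (hm : ∑ i, p i • Y i = 0) {r : ℝ} (hr : 0 ≤ r)
    (hv : ∀ v : n → ℝ, ∑ i, p i * (v ⬝ᵥ (Y i * Y i) *ᵥ v) ≤ r * (v ⬝ᵥ v)) (t : ℕ) (a : ℝ) :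
    sampleProb p t (fun s => ∃ v : n → ℝ, a * (v ⬝ᵥ v) < v ⬝ᵥ (∑ j, Y (s j)) *ᵥ v)
      ≤ Fintype.card n * Real.exp (t * r - a) := by
  have hsym : ∀ s : Fin t → α, (∑ j, Y (s j))ᵀ = ∑ j, Y (s j) := fun s => by
    simp [Matrix.transpose_sum, hY]
  have htr : ∀ s : Fin t → α, 0 ≤ (NormedSpace.exp (∑ j, Y (s j))).trace := by
    intro s
    obtain ⟨U, d, hU, h⟩ := exists_eq_conjDiag (hsym s)
    rw [h, exp_conjDiag hU, trace_conjDiag hU]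
    exact Finset.sum_nonneg fun _ _ => (Real.exp_pos _).le
  refine (sampleProb_mono h0 fun s hs => exp_le_trace_exp (hsym s) hs).trans ?_
  refine (sampleProb_le_of_sampleExp_le h0 htr (Real.exp_pos a)
    (sampleExp_trace_exp_le h0 h1 hY hb hm hr hv t)).trans ?_
  rw [Real.exp_sub, mul_comm ((1 + r) ^ t), mul_div_assoc, Real.exp_nat_mul]
  gcongr
  linarith [Real.add_one_le_exp r]

end

/-! ### Moments of the sampled matrices -/

section
variable {n t : ℕ} {p : Fin n → ℝ}

theorem frobSq_nonneg {a b : ℕ} (M : Matrix (Fin a) (Fin b) ℝ) : 0 ≤ frobSq M :=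
  Finset.sum_nonneg fun _ _ => Finset.sum_nonneg fun _ _ => sq_nonneg _

theorem samplingMatrix_transpose_mul_apply (h0 : ∀ i, 0 ≤ p i) {m : ℕ}
    (M : Matrix (Fin n) (Fin m) ℝ) (s : Fin t → Fin n) (j : Fin t) (b : Fin m) :
    ((samplingMatrix p s)ᵀ * M) j b ^ 2 = (t * p (s j))⁻¹ * M (s j) b ^ 2 := by
  have e : ((samplingMatrix p s)ᵀ * M) j b = 1 / √(t * p (s j)) * M (s j) b := by
    simp [Matrix.mul_apply, samplingMatrix]
  rw [e, mul_pow, div_pow, Real.sq_sqrt (mul_nonneg (Nat.cast_nonneg _) (h0 _)), one_pow, one_div]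

theorem samplingMatrix_mul_transpose (h0 : ∀ i, 0 ≤ p i) (s : Fin t → Fin n) :
    samplingMatrix p s * (samplingMatrix p s)ᵀ
      = ∑ j, diagonal (Pi.single (s j) (t * p (s j))⁻¹) := by
  ext a b
  rw [Matrix.mul_apply, Matrix.sum_apply]
  refine Finset.sum_congr rfl fun j _ => ?_
  have hs : √(t * p (s j)) * √(t * p (s j)) = t * p (s j) :=
    Real.mul_self_sqrt (mul_nonneg (Nat.cast_nonneg _) (h0 _))
  simp only [samplingMatrix, Matrix.of_apply, Matrix.transpose_apply, Matrix.diagonal_apply,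
    Pi.single_apply]
  by_cases ha : a = s j <;> by_cases hb : b = s j
  · simp only [ha, hb, if_true]
    rw [div_mul_div_comm, hs, one_mul, one_div]
  · simp [ha, hb, Ne.symm hb]
  · simp [ha]
  · simp [ha]

/-- A weighted sample of `∑ i, g i` is unbiased as soon as `g` vanishes where `p` does, and its
variance is at most `∑ i, g i ^ 2 / (t * p i)`. -/
theorem sampleExp_weighted_sum_sub_sq_le (h1 : ∑ i, p i = 1) (ht : 0 < t)
    (g : Fin n → ℝ) (hg : ∀ i, p i = 0 → g i = 0) :
    sampleExp p t (fun s => (∑ j, (t * p (s j))⁻¹ * g (s j) - ∑ i, g i) ^ 2)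
      ≤ ∑ i, (t * p i)⁻¹ * g i ^ 2 := by
  have ht' : (t : ℝ) ≠ 0 := by positivity
  have h := sampleExp_sum_sub_sq_le h1 t fun i => (t * p i)⁻¹ * g i
  have e1 : t * ∑ i, p i * ((t * p i)⁻¹ * g i) = ∑ i, g i := by
    rw [Finset.mul_sum]
    refine Finset.sum_congr rfl fun i _ => ?_
    by_cases hp : p i = 0
    · simp [hp, hg i hp]
    · field_simp
  have e2 : t * ∑ i, p i * ((t * p i)⁻¹ * g i) ^ 2 = ∑ i, (t * p i)⁻¹ * g i ^ 2 := by
    rw [Finset.mul_sum]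
    refine Finset.sum_congr rfl fun i _ => ?_
    by_cases hp : p i = 0
    · simp [hp]
    · field_simp
  rwa [e1, e2] at h

theorem inv_weight_mul_le (h0 : ∀ i, 0 ≤ p i) {K x : ℝ} (hK : 0 ≤ K) {i : Fin n}
    (hx : x ≤ K * (t * p i)) : (t * p i)⁻¹ * x ≤ K := by
  rcases (mul_nonneg (Nat.cast_nonneg t) (h0 i)).eq_or_lt with h | h
  · rw [← h]; simpa using hK
  · rw [inv_mul_eq_div, div_le_iff₀ h]; exact hx

/-- Approximate matrix multiplication, in the case of a vanishing product. -/
theorem sampleExp_frobSq_mul_sampling_mul_le (h0 : ∀ i, 0 ≤ p i) (h1 : ∑ i, p i = 1) (ht : 0 < t)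
    {a b : ℕ} (X : Matrix (Fin a) (Fin n) ℝ) (Y : Matrix (Fin n) (Fin b) ℝ) (hXY : X * Y = 0)
    {K : ℝ} (hK : 0 ≤ K) (hX : ∀ i, ∑ a, X a i ^ 2 ≤ K * (t * p i)) :
    sampleExp p t (fun s => frobSq (X * (samplingMatrix p s * (samplingMatrix p s)ᵀ) * Y))
      ≤ K * frobSq Y := by
  have hz : ∀ a i, p i = 0 → X a i = 0 := by
    intro a i hp
    have := hX i
    rw [hp, mul_zero, mul_zero] at this
    have h2 := Finset.single_le_sum (f := fun a => X a i ^ 2) (fun _ _ => sq_nonneg _)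
      (Finset.mem_univ a)
    exact pow_eq_zero_iff two_ne_zero |>.mp (le_antisymm (h2.trans this) (sq_nonneg _))
  have e : ∀ s : Fin t → Fin n, ∀ c d,
      (X * (samplingMatrix p s * (samplingMatrix p s)ᵀ) * Y) c d
        = ∑ j, (t * p (s j))⁻¹ * (X c (s j) * Y (s j) d) - ∑ i, X c i * Y i d := by
    intro s c d
    have : ∑ i, X c i * Y i d = 0 := by
      rw [← Matrix.mul_apply, hXY, Matrix.zero_apply]
    rw [this, sub_zero, samplingMatrix_mul_transpose h0, Matrix.mul_sum, Matrix.sum_mul,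
      Matrix.sum_apply]
    refine Finset.sum_congr rfl fun j _ => ?_
    rw [Matrix.mul_apply]
    simp only [Matrix.mul_diagonal]
    rw [Finset.sum_eq_single (s j)]
    · simp; ring
    · intro x _ hx; simp [hx]
    · simp
  simp only [frobSq, e, sampleExp_sum]
  calc _ ≤ ∑ c, ∑ d, ∑ i, (t * p i)⁻¹ * (X c i * Y i d) ^ 2 :=
        Finset.sum_le_sum fun c _ => Finset.sum_le_sum fun d _ =>
          sampleExp_weighted_sum_sub_sq_le h1 ht _ fun i hp => by simp [hz c i hp]
    _ = ∑ i, ∑ d, ((t * p i)⁻¹ * ∑ c, X c i ^ 2) * Y i d ^ 2 := by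
        simp only [mul_pow, Finset.mul_sum, Finset.sum_mul]
        rw [Finset.sum_congr rfl fun c _ => Finset.sum_comm, Finset.sum_comm]
        refine Finset.sum_congr rfl fun i _ => ?_
        rw [Finset.sum_comm]
        exact Finset.sum_congr rfl fun d _ => Finset.sum_congr rfl fun c _ => by ring
    _ ≤ ∑ i, ∑ d, K * Y i d ^ 2 :=
        Finset.sum_le_sum fun i _ => Finset.sum_le_sum fun d _ =>
          mul_le_mul_of_nonneg_right (inv_weight_mul_le h0 hK (hX i)) (sq_nonneg _)
    _ = _ := by simp only [Finset.mul_sum]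

theorem frobSq_sampling_transpose_mul (h0 : ∀ i, 0 ≤ p i) {m : ℕ} (M : Matrix (Fin n) (Fin m) ℝ)
    (s : Fin t → Fin n) :
    frobSq ((samplingMatrix p s)ᵀ * M) = ∑ j, (t * p (s j))⁻¹ * ∑ b, M (s j) b ^ 2 := by
  simp only [frobSq, samplingMatrix_transpose_mul_apply h0, Finset.mul_sum]

/-- Variance of the sampled Frobenius mass of `M`. -/
theorem sampleExp_frobSq_sub_sq_le (h0 : ∀ i, 0 ≤ p i) (h1 : ∑ i, p i = 1) (ht : 0 < t)
    {m : ℕ} (M : Matrix (Fin n) (Fin m) ℝ) {K : ℝ} (hK : 0 ≤ K)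
    (hM : ∀ i, ∑ b, M i b ^ 2 ≤ K * (t * p i)) :
    sampleExp p t (fun s => (frobSq ((samplingMatrix p s)ᵀ * M) - frobSq M) ^ 2)
      ≤ K * frobSq M := by
  simp only [frobSq_sampling_transpose_mul h0]
  have hnn : ∀ i, 0 ≤ ∑ b, M i b ^ 2 := fun i => Finset.sum_nonneg fun _ _ => sq_nonneg _
  refine (sampleExp_weighted_sum_sub_sq_le h1 ht (fun i => ∑ b, M i b ^ 2) fun i hp => ?_).trans ?_
  · have := hM i
    rw [hp, mul_zero, mul_zero] at this
    exact le_antisymm this (hnn i)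
  · rw [frobSq, Finset.mul_sum]
    refine Finset.sum_le_sum fun i _ => ?_
    rw [sq, ← mul_assoc]
    exact mul_le_mul_of_nonneg_right (inv_weight_mul_le h0 hK (hM i)) (hnn i)

/-- Equality can fail: rows of `M` with probability `0` are never sampled. -/
theorem sampleExp_frobSq_le (h0 : ∀ i, 0 ≤ p i) (h1 : ∑ i, p i = 1) {m : ℕ}
    (M : Matrix (Fin n) (Fin m) ℝ) :
    sampleExp p t (fun s => frobSq ((samplingMatrix p s)ᵀ * M)) ≤ frobSq M := by
  simp only [frobSq_sampling_transpose_mul h0]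
  rw [sampleExp_sum_apply h1 t fun i => (t * p i)⁻¹ * ∑ b, M i b ^ 2, frobSq, Finset.mul_sum]
  refine Finset.sum_le_sum fun i _ => ?_
  have hnn : 0 ≤ ∑ b, M i b ^ 2 := Finset.sum_nonneg fun _ _ => sq_nonneg _
  calc t * (p i * ((t * p i)⁻¹ * ∑ b, M i b ^ 2)) = (t * p i) * (t * p i)⁻¹ * ∑ b, M i b ^ 2 := by
        ring
    _ ≤ 1 * ∑ b, M i b ^ 2 := mul_le_mul_of_nonneg_right (mul_inv_le_one) hnn
    _ = _ := one_mul _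

/-! ### Spectral approximation by sampling -/

/-- One-sided form of `sampleProb_quadForm_sampling_le`; the factor `θ` may be negative,
which gives both tails. -/
theorem sampleProb_lt_quadForm_sampling_le (h0 : ∀ i, 0 ≤ p i) (h1 : ∑ i, p i = 1) (ht : 0 < t)
    {B : Matrix (Fin n) (Fin n) ℝ} (hB : Bᵀ = B) (hB1 : ∀ v, v ⬝ᵥ (B * B) *ᵥ v ≤ v ⬝ᵥ v)
    {L : ℝ} (hL : 0 < L) (hβ : ∀ i, (B * B) i i ≤ L * (t * p i)) {θ : ℝ} (hθ : |θ| * L ≤ 1)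
    (a : ℝ) :
    sampleProb p t (fun s => ∃ v : Fin n → ℝ, a * (v ⬝ᵥ v) < θ * (v ⬝ᵥ
      (B * (samplingMatrix p s * (samplingMatrix p s)ᵀ - 1) * B) *ᵥ v))
      ≤ n * Real.exp (θ ^ 2 * L - a) := by
  have ht' : (0 : ℝ) < t := by exact_mod_cast ht
  set w : Fin n → ℝ := fun i => (t * p i)⁻¹ with hw
  have hw0 : ∀ i, 0 ≤ w i := fun i => inv_nonneg.mpr (mul_nonneg ht'.le (h0 i))
  have hnorm : ∀ i, B i ⬝ᵥ B i = (B * B) i i := fun i => by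
    rw [Matrix.mul_apply]
    refine Finset.sum_congr rfl fun j _ => ?_
    have hs : B j i = B i j := congrFun (congrFun hB i) j
    rw [hs]
  have hwb : ∀ i, w i * (B i ⬝ᵥ B i) ≤ L := fun i => by
    rw [hnorm]; exact inv_weight_mul_le h0 hL.le (hβ i)
  -- A row of probability `0` vanishes, so the junk weight `w i = 0⁻¹ = 0` loses nothing.
  have hpw : ∀ i, p i * w i = (t : ℝ)⁻¹ ∨ B i = 0 := by
    intro i
    by_cases hp : p i = 0
    · right
      have := hβ i
      rw [hp, mul_zero, mul_zero, ← hnorm] at this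
      exact dotProduct_self_eq_zero.mp (le_antisymm this
        (Finset.sum_nonneg fun _ _ => mul_self_nonneg _))
    · left
      simp only [hw]; field_simp
  set X : Fin n → Matrix (Fin n) (Fin n) ℝ := fun i => w i • vecMulVec (B i) (B i) with hX
  have hXv : ∀ i v, X i *ᵥ v = (w i * (B i ⬝ᵥ v)) • B i := fun i v => by
    simp only [hX, Matrix.smul_mulVec, Matrix.vecMulVec_mulVec]
    ext j; simp; ring
  have hXt : ∀ i, (X i)ᵀ = X i := fun i => by
    simp only [hX, Matrix.transpose_smul, Matrix.transpose_vecMulVec]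
  have hBv : ∀ i (v : Fin n → ℝ), B i ⬝ᵥ v = (B *ᵥ v) i := fun i v => rfl
  have hquad : ∀ v : Fin n → ℝ, v ⬝ᵥ (B * B) *ᵥ v = ∑ i, (B i ⬝ᵥ v) ^ 2 := fun v => by
    rw [← Matrix.mulVec_mulVec, Matrix.dotProduct_mulVec, ← Matrix.mulVec_transpose, hB]
    simp only [dotProduct, sq]; rfl
  set m : Matrix (Fin n) (Fin n) ℝ := (t : ℝ)⁻¹ • (B * B) with hm
  have hmt : mᵀ = m := by simp [hm, hB]
  have hmean : ∑ i, p i • X i = m := by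
    ext a b
    rw [Matrix.sum_apply, hm, Matrix.smul_apply, Matrix.mul_apply, smul_eq_mul, Finset.mul_sum]
    refine Finset.sum_congr rfl fun i _ => ?_
    have hs : B a i = B i a := congrFun (congrFun hB i) a
    simp only [hX, Matrix.smul_apply, Matrix.vecMulVec_apply, smul_eq_mul, hs]
    rcases hpw i with h | h
    · rw [← h]; ring
    · simp [h]
  have hXq : ∀ i v, v ⬝ᵥ X i *ᵥ v = w i * (B i ⬝ᵥ v) ^ 2 := fun i v => by
    rw [hXv, dotProduct_smul, smul_eq_mul, dotProduct_comm v]; ring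
  have hXle : ∀ i v, v ⬝ᵥ X i *ᵥ v ≤ L * (v ⬝ᵥ v) := fun i v => by
    rw [hXq]
    have hcs : (B i ⬝ᵥ v) ^ 2 ≤ (B i ⬝ᵥ B i) * (v ⬝ᵥ v) := by
      have := Finset.sum_mul_sq_le_sq_mul_sq Finset.univ (B i) v
      simpa only [dotProduct, sq] using this
    have hvv : 0 ≤ v ⬝ᵥ v := Finset.sum_nonneg fun _ _ => mul_self_nonneg _
    calc w i * (B i ⬝ᵥ v) ^ 2 ≤ w i * ((B i ⬝ᵥ B i) * (v ⬝ᵥ v)) :=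
          mul_le_mul_of_nonneg_left hcs (hw0 i)
      _ = (w i * (B i ⬝ᵥ B i)) * (v ⬝ᵥ v) := by ring
      _ ≤ _ := mul_le_mul_of_nonneg_right (hwb i) hvv
  have hX0 : ∀ i v, 0 ≤ v ⬝ᵥ X i *ᵥ v := fun i v => by
    rw [hXq]; exact mul_nonneg (hw0 i) (sq_nonneg _)
  have hmq : ∀ v, v ⬝ᵥ m *ᵥ v = ∑ i, p i * (v ⬝ᵥ X i *ᵥ v) := fun v => by
    rw [← hmean]
    simp [Matrix.sum_mulVec, dotProduct_sum, Matrix.smul_mulVec, dotProduct_smul]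
  have hm0 : ∀ v, 0 ≤ v ⬝ᵥ m *ᵥ v := fun v => by
    rw [hmq]; exact Finset.sum_nonneg fun i _ => mul_nonneg (h0 i) (hX0 i v)
  have hmle : ∀ v, v ⬝ᵥ m *ᵥ v ≤ L * (v ⬝ᵥ v) := fun v => by
    rw [hmq]
    calc _ ≤ ∑ i, p i * (L * (v ⬝ᵥ v)) :=
          Finset.sum_le_sum fun i _ => mul_le_mul_of_nonneg_left (hXle i v) (h0 i)
      _ = _ := by rw [← Finset.sum_mul, h1, one_mul]
  have hY := sampleProb_exists_lt_quadForm_le (p := p) h0 h1 (Y := fun i => θ • (X i - m))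
    (fun i => by rw [Matrix.transpose_smul, Matrix.transpose_sub, hXt, hmt])
    (fun i v => by
      rw [Matrix.smul_mulVec, dotProduct_smul, Matrix.sub_mulVec, dotProduct_sub, smul_eq_mul,
        abs_mul]
      have hvv : 0 ≤ v ⬝ᵥ v := Finset.sum_nonneg fun _ _ => mul_self_nonneg _
      have habs : |v ⬝ᵥ X i *ᵥ v - v ⬝ᵥ m *ᵥ v| ≤ L * (v ⬝ᵥ v) := by
        rw [abs_le]; constructor <;> linarith [hX0 i v, hXle i v, hm0 v, hmle v]
      calc |θ| * |v ⬝ᵥ X i *ᵥ v - v ⬝ᵥ m *ᵥ v| ≤ |θ| * (L * (v ⬝ᵥ v)) := by gcongr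
        _ = (|θ| * L) * (v ⬝ᵥ v) := by ring
        _ ≤ 1 * (v ⬝ᵥ v) := by gcongr
        _ = _ := one_mul _)
    (by
      have : ∀ i, p i • θ • (X i - m) = θ • (p i • X i) - (p i) • (θ • m) := fun i => by
        rw [smul_sub, smul_sub, smul_comm]
      simp only [this, Finset.sum_sub_distrib, ← Finset.smul_sum, hmean, ← Finset.sum_smul, h1,
        one_smul, sub_self])
    (r := θ ^ 2 * (L / t)) (by positivity)
    (fun v => by
      have hsq : ∀ i, v ⬝ᵥ (θ • (X i - m) * θ • (X i - m)) *ᵥ v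
          = θ ^ 2 * (v ⬝ᵥ (X i * X i) *ᵥ v) - θ ^ 2 * (v ⬝ᵥ (X i * m) *ᵥ v)
            - θ ^ 2 * (v ⬝ᵥ (m * X i) *ᵥ v) + θ ^ 2 * (v ⬝ᵥ (m * m) *ᵥ v) := fun i => by
        have : θ • (X i - m) * θ • (X i - m)
            = (θ ^ 2) • (X i * X i - X i * m - m * X i + m * m) := by
          rw [Matrix.smul_mul, Matrix.mul_smul, smul_smul, ← sq]
          congr 1; noncomm_ring
        rw [this, Matrix.smul_mulVec, dotProduct_smul, Matrix.add_mulVec, Matrix.sub_mulVec,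
          Matrix.sub_mulVec, dotProduct_add, dotProduct_sub, dotProduct_sub, smul_eq_mul]
        ring
      have hXm : ∑ i, p i * (v ⬝ᵥ (X i * m) *ᵥ v) = v ⬝ᵥ (m * m) *ᵥ v := by
        conv_rhs => rw [← hmean, Matrix.sum_mul]
        simp [Matrix.sum_mulVec, dotProduct_sum, Matrix.smul_mulVec, dotProduct_smul, hmean]
      have hmX : ∑ i, p i * (v ⬝ᵥ (m * X i) *ᵥ v) = v ⬝ᵥ (m * m) *ᵥ v := by
        conv_rhs => rw [← hmean, Matrix.mul_sum]
        simp [Matrix.sum_mulVec, dotProduct_sum, Matrix.smul_mulVec, dotProduct_smul, hmean]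
      have hmm : 0 ≤ v ⬝ᵥ (m * m) *ᵥ v := by
        rw [← Matrix.mulVec_mulVec, Matrix.dotProduct_mulVec, ← Matrix.mulVec_transpose, hmt]
        exact Finset.sum_nonneg fun _ _ => mul_self_nonneg _
      have hXX : ∑ i, p i * (v ⬝ᵥ (X i * X i) *ᵥ v) ≤ L / t * (v ⬝ᵥ v) := by
        calc ∑ i, p i * (v ⬝ᵥ (X i * X i) *ᵥ v)
            ≤ ∑ i, L * ((t : ℝ)⁻¹ * (B i ⬝ᵥ v) ^ 2) := by
              refine Finset.sum_le_sum fun i _ => ?_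
              have e : v ⬝ᵥ (X i * X i) *ᵥ v
                  = w i * (B i ⬝ᵥ B i) * (w i * (B i ⬝ᵥ v) ^ 2) := by
                rw [← Matrix.mulVec_mulVec, hXv i v, Matrix.mulVec_smul, hXv, dotProduct_smul,
                  dotProduct_smul, smul_eq_mul, smul_eq_mul, dotProduct_comm v]
                ring
              rw [e]
              rcases hpw i with h | h
              · rw [← h]
                calc p i * (w i * (B i ⬝ᵥ B i) * (w i * (B i ⬝ᵥ v) ^ 2))
                    = (w i * (B i ⬝ᵥ B i)) * (p i * w i * (B i ⬝ᵥ v) ^ 2) := by ring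
                  _ ≤ L * (p i * w i * (B i ⬝ᵥ v) ^ 2) :=
                      mul_le_mul_of_nonneg_right (hwb i)
                        (mul_nonneg (mul_nonneg (h0 i) (hw0 i)) (sq_nonneg _))
              · simp [h]
          _ = L / t * (v ⬝ᵥ (B * B) *ᵥ v) := by
              rw [hquad, ← Finset.mul_sum, ← Finset.mul_sum]; ring
          _ ≤ _ := by gcongr; exact hB1 v
      simp only [hsq, mul_add, mul_sub, Finset.sum_add_distrib, Finset.sum_sub_distrib,
        mul_left_comm _ (θ ^ 2), ← Finset.mul_sum, hXm, hmX, ← Finset.sum_mul, h1]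
      nlinarith [mul_le_mul_of_nonneg_left hXX (sq_nonneg θ), mul_nonneg (sq_nonneg θ) hmm])
    t a
  have hsum : ∀ s : Fin t → Fin n, ∑ j, θ • (X (s j) - m)
      = θ • (B * (samplingMatrix p s * (samplingMatrix p s)ᵀ - 1) * B) := by
    intro s
    rw [← Finset.smul_sum, Finset.sum_sub_distrib, Finset.sum_const, Finset.card_univ,
      Fintype.card_fin, ← Nat.cast_smul_eq_nsmul ℝ, hm, smul_smul, mul_inv_cancel₀ ht'.ne', one_smul,
      Matrix.mul_sub, Matrix.sub_mul, Matrix.mul_one, samplingMatrix_mul_transpose h0,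
      Matrix.mul_sum, Matrix.sum_mul]
    congr 2
    refine Finset.sum_congr rfl fun j _ => ?_
    ext a b
    have hs : B a (s j) = B (s j) a := congrFun (congrFun hB (s j)) a
    rw [Matrix.mul_apply]
    simp only [Matrix.mul_diagonal]
    rw [Finset.sum_eq_single (s j)]
    · simp only [hX, hw, Matrix.smul_apply, Matrix.vecMulVec_apply, smul_eq_mul, Pi.single_eq_same,
        hs]
      ring
    · intro x _ hx; simp [hx]
    · simp
  simp only [hsum, Matrix.smul_mulVec, dotProduct_smul, smul_eq_mul, Fintype.card_fin] at hY
  have e : (t : ℝ) * (θ ^ 2 * (L / t)) = θ ^ 2 * L := by field_simp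
  rwa [e] at hY

/-- Matrix Bernstein for importance sampling: if the squared row norms of `B` are at most
`L * t * p i` and `‖B‖ ≤ 1`, then `B * S * Sᵀ * B` is within `δ` of `B * B` in operator norm. -/
theorem sampleProb_quadForm_sampling_le (h0 : ∀ i, 0 ≤ p i) (h1 : ∑ i, p i = 1) (ht : 0 < t)
    {B : Matrix (Fin n) (Fin n) ℝ} (hB : Bᵀ = B) (hB1 : ∀ v, v ⬝ᵥ (B * B) *ᵥ v ≤ v ⬝ᵥ v)
    {L : ℝ} (hL : 0 < L) (hβ : ∀ i, (B * B) i i ≤ L * (t * p i)) {δ : ℝ} (hδ : 0 < δ)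
    (hδ2 : δ ≤ 2) :
    sampleProb p t (fun s => ¬ ∀ v : Fin n → ℝ, |v ⬝ᵥ
      (B * (samplingMatrix p s * (samplingMatrix p s)ᵀ - 1) * B) *ᵥ v| ≤ δ * (v ⬝ᵥ v))
      ≤ 2 * (n * Real.exp (-(δ ^ 2 / (4 * L)))) := by
  -- This `θ` minimizes the exponent `θ ^ 2 * L - θ * δ`.
  set θ := δ / (2 * L) with hθ
  have hθ0 : 0 < θ := by positivity
  have hθL : θ * L = δ / 2 := by rw [hθ]; field_simp
  have hexp : θ ^ 2 * L - θ * δ = -(δ ^ 2 / (4 * L)) := by rw [hθ]; field_simp; ring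
  have hp := sampleProb_lt_quadForm_sampling_le h0 h1 ht hB hB1 hL hβ (θ := θ)
    (by rw [abs_of_pos hθ0]; linarith) (θ * δ)
  have hn := sampleProb_lt_quadForm_sampling_le h0 h1 ht hB hB1 hL hβ (θ := -θ)
    (by rw [abs_neg, abs_of_pos hθ0]; linarith) (θ * δ)
  rw [neg_sq, hexp] at hn
  rw [hexp] at hp
  rw [two_mul]
  refine (sampleProb_mono h0 fun s hs => ?_).trans ((sampleProb_or_le h0 _ _).trans
    (add_le_add hp hn))
  push Not at hs
  obtain ⟨v, hv⟩ := hs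
  rcases lt_abs.mp hv with h | h
  · left
    refine ⟨v, ?_⟩
    rw [mul_assoc]
    exact mul_lt_mul_of_pos_left h hθ0
  · right
    refine ⟨v, ?_⟩
    rw [mul_assoc, neg_mul, ← mul_neg]
    exact mul_lt_mul_of_pos_left h hθ0

end

/-! ### The Frobenius norm and orthogonal projections -/

section
variable {m n l : ℕ}

theorem frobSq_eq_trace (M : Matrix (Fin m) (Fin n) ℝ) : frobSq M = (Mᵀ * M).trace := by
  simp only [frobSq, Matrix.trace, Matrix.diag, Matrix.mul_apply, Matrix.transpose_apply, ← sq]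
  exact Finset.sum_comm

theorem frobSq_transpose (M : Matrix (Fin m) (Fin n) ℝ) : frobSq Mᵀ = frobSq M := by
  simp only [frobSq, Matrix.transpose_apply]
  exact Finset.sum_comm

theorem frobSq_add (X Y : Matrix (Fin m) (Fin n) ℝ) :
    frobSq (X + Y) = frobSq X + frobSq Y + 2 * (Xᵀ * Y).trace := by
  have h : (Yᵀ * X).trace = (Xᵀ * Y).trace := by
    rw [← Matrix.trace_transpose, Matrix.transpose_mul, Matrix.transpose_transpose]
  simp only [frobSq_eq_trace, Matrix.transpose_add, Matrix.add_mul, Matrix.mul_add,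
    Matrix.trace_add, h]
  ring

theorem abs_trace_transpose_mul_le (X Y : Matrix (Fin m) (Fin n) ℝ) :
    |(Xᵀ * Y).trace| ≤ √(frobSq X) * √(frobSq Y) := by
  rw [← Real.sqrt_mul (frobSq_nonneg X)]
  refine Real.abs_le_sqrt ?_
  have e : (Xᵀ * Y).trace = ∑ q : Fin m × Fin n, X q.1 q.2 * Y q.1 q.2 := by
    simp only [Matrix.trace, Matrix.diag, Matrix.mul_apply, Matrix.transpose_apply,
      Fintype.sum_prod_type]
    exact Finset.sum_comm
  have f : ∀ Z : Matrix (Fin m) (Fin n) ℝ, frobSq Z = ∑ q : Fin m × Fin n, Z q.1 q.2 ^ 2 :=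
    fun Z => by simp only [frobSq, Fintype.sum_prod_type]
  rw [e, f, f]
  exact Finset.sum_mul_sq_le_sq_mul_sq _ _ _

theorem trace_transpose_mul_mul (M : Matrix (Fin m) (Fin n) ℝ) (G : Matrix (Fin m) (Fin m) ℝ) :
    (Mᵀ * G * M).trace = ∑ b, M.col b ⬝ᵥ G *ᵥ M.col b := by
  refine Finset.sum_congr rfl fun b _ => ?_
  rw [Matrix.diag_apply, Matrix.mul_assoc]
  rfl

theorem frobSq_mul_le_of_quadForm_le {X Y : Matrix (Fin l) (Fin m) ℝ} {c : ℝ}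
    (h : ∀ v, (X *ᵥ v) ⬝ᵥ (X *ᵥ v) ≤ c * ((Y *ᵥ v) ⬝ᵥ (Y *ᵥ v))) (M : Matrix (Fin m) (Fin n) ℝ) :
    frobSq (X * M) ≤ c * frobSq (Y * M) := by
  have e : ∀ Z : Matrix (Fin l) (Fin m) ℝ, frobSq (Z * M) = ∑ b, (Z *ᵥ M.col b) ⬝ᵥ (Z *ᵥ M.col b) :=
    fun Z => by rw [frobSq_eq_trace]; rfl
  rw [e, e, Finset.mul_sum]
  exact Finset.sum_le_sum fun b _ => h _

theorem frobSq_mul_le_of_norm_le {X : Matrix (Fin l) (Fin m) ℝ} {c : ℝ}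
    (h : ∀ v, (X *ᵥ v) ⬝ᵥ (X *ᵥ v) ≤ c * (v ⬝ᵥ v)) (M : Matrix (Fin m) (Fin n) ℝ) :
    frobSq (X * M) ≤ c * frobSq M := by
  have e : ∀ Z : Matrix (Fin l) (Fin m) ℝ, frobSq (Z * M) = ∑ b, (Z *ᵥ M.col b) ⬝ᵥ (Z *ᵥ M.col b) :=
    fun Z => by rw [frobSq_eq_trace]; rfl
  have e' : frobSq M = ∑ b, M.col b ⬝ᵥ M.col b := by rw [frobSq_eq_trace]; rfl
  rw [e, e', Finset.mul_sum]
  exact Finset.sum_le_sum fun b _ => h _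

theorem frobSq_mul_one_sub {P : Matrix (Fin n) (Fin n) ℝ} (hPt : Pᵀ = P) (hP : P * P = P)
    (M : Matrix (Fin m) (Fin n) ℝ) : frobSq (M * (1 - P)) = frobSq M - frobSq (M * P) := by
  have h : frobSq M = frobSq (M * (1 - P) + M * P) := by
    rw [← Matrix.mul_add, sub_add_cancel, Matrix.mul_one]
  rw [h, frobSq_add]
  have : ((M * (1 - P))ᵀ * (M * P)).trace = 0 := by
    rw [Matrix.trace_mul_comm, Matrix.transpose_mul, Matrix.transpose_sub, Matrix.transpose_one,
      hPt, Matrix.mul_assoc, ← Matrix.mul_assoc P, Matrix.mul_sub, hP, Matrix.mul_one, sub_self,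
      Matrix.zero_mul, Matrix.mul_zero, Matrix.trace_zero]
  rw [this]; ring

theorem frobSq_mul_proj_le {P : Matrix (Fin n) (Fin n) ℝ} (hPt : Pᵀ = P) (hP : P * P = P)
    (M : Matrix (Fin m) (Fin n) ℝ) : frobSq (M * P) ≤ frobSq M := by
  have := frobSq_mul_one_sub hPt hP M
  linarith [frobSq_nonneg (M * (1 - P))]

theorem frobSq_mul_one_sub_le {P : Matrix (Fin n) (Fin n) ℝ} (hPt : Pᵀ = P) (hP : P * P = P)
    (M : Matrix (Fin m) (Fin n) ℝ) : frobSq (M * (1 - P)) ≤ frobSq M := by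
  have := frobSq_mul_one_sub hPt hP M
  linarith [frobSq_nonneg (M * P)]

theorem frobSq_proj_mul_le {P : Matrix (Fin m) (Fin m) ℝ} (hPt : Pᵀ = P) (hP : P * P = P)
    (M : Matrix (Fin m) (Fin n) ℝ) : frobSq (P * M) ≤ frobSq M := by
  have := frobSq_mul_proj_le hPt hP Mᵀ
  rwa [← frobSq_transpose (Mᵀ * P), Matrix.transpose_mul, Matrix.transpose_transpose, hPt,
    frobSq_transpose] at this

theorem frobSq_proj_eq_rank {P : Matrix (Fin n) (Fin n) ℝ} (hPt : Pᵀ = P) (hP : P * P = P) :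
    frobSq P = P.rank := by
  obtain ⟨U, d, hU, rfl⟩ := exists_eq_conjDiag hPt
  have hd : ∀ j, d j * d j = d j := fun j => by
    have := congrArg (fun M => U.col j ⬝ᵥ M *ᵥ U.col j) hP
    simpa only [conjDiag_mul hU, col_dotProduct_conjDiag hU] using this
  have hUu : IsUnit U.det := Matrix.isUnit_det_of_left_inverse hU
  have hUtu : IsUnit (Uᵀ).det := by rwa [Matrix.det_transpose]
  have hr : (conjDiag U d).rank = Fintype.card {j // d j ≠ 0} := by
    rw [conjDiag, Matrix.rank_mul_eq_left_of_isUnit_det _ _ hUtu,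
      Matrix.rank_mul_eq_right_of_isUnit_det _ _ hUu, Matrix.rank_diagonal]
  rw [frobSq_eq_trace, conjDiag_transpose, conjDiag_mul hU, trace_conjDiag hU, hr,
    Fintype.card_subtype, Finset.card_filter]
  push_cast
  refine Finset.sum_congr rfl fun j _ => ?_
  rw [hd]
  by_cases h : d j = 0
  · simp [h]
  · have : d j = 1 := mul_left_cancel₀ h (by rw [hd, mul_one])
    simp [this]

/-- `W` is the orthogonal projection onto the column space of `M`. -/
theorem exists_proj_mul_eq (M : Matrix (Fin m) (Fin n) ℝ) :
    ∃ W : Matrix (Fin m) (Fin m) ℝ, Wᵀ = W ∧ W * W = W ∧ W.rank ≤ M.rank ∧ W * M = M := by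
  have h := isMoorePenrose_pinv M
  refine ⟨M * pinv M, h.symm_left, ?_, Matrix.rank_mul_le_left _ _, h.mul_mul⟩
  rw [← Matrix.mul_assoc, h.mul_mul]

/-! ### Best low-rank approximation -/

theorem tailSq_le {M B : Matrix (Fin m) (Fin n) ℝ} {k : ℕ} (hB : B.rank ≤ k) :
    tailSq M k ≤ frobSq (M - B) :=
  csInf_le ⟨0, by rintro _ ⟨B, -, rfl⟩; exact frobSq_nonneg _⟩ ⟨B, hB, rfl⟩

theorem tailSq_nonneg (M : Matrix (Fin m) (Fin n) ℝ) (k : ℕ) : 0 ≤ tailSq M k :=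
  Real.sInf_nonneg (by rintro _ ⟨B, -, rfl⟩; exact frobSq_nonneg _)

/-- The infimum over matrices of rank at most `k` may be taken over projections onto subspaces of
dimension at most `k`. -/
theorem le_tailSq {M : Matrix (Fin m) (Fin n) ℝ} {k : ℕ} {x : ℝ}
    (h : ∀ W : Matrix (Fin n) (Fin n) ℝ, Wᵀ = W → W * W = W → W.rank ≤ k →
      x ≤ frobSq (M * (1 - W))) : x ≤ tailSq M k := by
  refine le_csInf ⟨_, 0, by simp, rfl⟩ ?_
  rintro _ ⟨B, hB, rfl⟩
  obtain ⟨W, hWt, hW, hr, hWB⟩ := exists_proj_mul_eq Bᵀ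
  have hBW : B * W = B := by
    have := congrArg Matrix.transpose hWB
    rwa [Matrix.transpose_mul, Matrix.transpose_transpose, hWt] at this
  refine (h W hWt hW (hr.trans (by rwa [Matrix.rank_transpose]))).trans ?_
  have e : M * (1 - W) = (M - B) * (1 - W) := by
    rw [Matrix.sub_mul, Matrix.mul_sub B, hBW, Matrix.mul_one, sub_self, sub_zero]
  rw [e]
  exact frobSq_mul_one_sub_le hWt hW _

/-! ### Deterministic guarantee for a sketch -/

/-- Splitting `M` into `Q * M` and `(1 - Q) * M`: on the first part the sketch is a relative
embedding, the second part changes by the shift `frobSq ((1 - Q) * M) - frobSq (Sᵀ * (1 - Q) * M)`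
up to its small mass on the range of `P`, and the cross terms are small. -/
theorem abs_frobSq_sketch_add_sub_le {t : ℕ} (S : Matrix (Fin n) (Fin t) ℝ)
    (M : Matrix (Fin n) (Fin m) ℝ) {Q : Matrix (Fin n) (Fin n) ℝ} (hQt : Qᵀ = Q) (hQ : Q * Q = Q)
    {P : Matrix (Fin m) (Fin m) ℝ} (hPt : Pᵀ = P) (hP : P * P = P) {δ ρ γ : ℝ} (hδ : 0 ≤ δ)
    (ha : ∀ v, |v ⬝ᵥ (Q * (S * Sᵀ - 1) * Q) *ᵥ v| ≤ δ * (v ⬝ᵥ Q *ᵥ v))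
    (hb : frobSq ((1 - Q) * M * P) ≤ ρ) (hb' : frobSq (Sᵀ * ((1 - Q) * M) * P) ≤ ρ)
    (hγ : 0 ≤ γ) (hc : frobSq (Q * (S * Sᵀ) * ((1 - Q) * M)) ≤ γ ^ 2) :
    |frobSq (Sᵀ * M * (1 - P)) + (frobSq ((1 - Q) * M) - frobSq (Sᵀ * ((1 - Q) * M)))
        - frobSq (M * (1 - P))|
      ≤ δ * frobSq (M * (1 - P)) + ρ + 2 * (γ * √(frobSq (M * (1 - P)))) := by
  set H : Matrix (Fin m) (Fin m) ℝ := 1 - P with hH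
  have hHt : Hᵀ = H := by rw [hH, Matrix.transpose_sub, Matrix.transpose_one, hPt]
  have hHH : H * H = H := by
    rw [hH, Matrix.mul_sub, Matrix.sub_mul, Matrix.sub_mul, hP]; simp
  set N : Matrix (Fin n) (Fin n) ℝ := 1 - Q with hN
  have hQN : Q * N = 0 := by rw [hN, Matrix.mul_sub, hQ, Matrix.mul_one, sub_self]
  have hsplit : M * H = Q * M * H + N * M * H := by
    rw [← Matrix.add_mul, ← Matrix.add_mul, hN, add_sub_cancel, Matrix.one_mul]
  have hsplitS : Sᵀ * M * H = Sᵀ * (Q * M * H) + Sᵀ * (N * M * H) := by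
    rw [← Matrix.mul_add, ← hsplit, Matrix.mul_assoc]
  have hpyth : frobSq (M * H) = frobSq (Q * M * H) + frobSq (N * M * H) := by
    rw [hsplit, frobSq_add]
    have : (Q * M * H)ᵀ * (N * M * H) = 0 := by
      rw [Matrix.transpose_mul, Matrix.transpose_mul, hQt]
      calc Hᵀ * (Mᵀ * Q) * (N * M * H) = Hᵀ * Mᵀ * (Q * N) * M * H := by
            simp only [Matrix.mul_assoc]
        _ = 0 := by rw [hQN]; simp
    rw [this, Matrix.trace_zero]; ring
  have hhead : |frobSq (Sᵀ * (Q * M * H)) - frobSq (Q * M * H)| ≤ δ * frobSq (Q * M * H) := by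
    have e1 : frobSq (Sᵀ * (Q * M * H)) - frobSq (Q * M * H)
        = ((M * H)ᵀ * (Q * (S * Sᵀ - 1) * Q) * (M * H)).trace := by
      rw [frobSq_eq_trace, frobSq_eq_trace, ← Matrix.trace_sub]
      congr 1
      simp only [Matrix.transpose_mul, Matrix.transpose_transpose, hQt, Matrix.mul_sub,
        Matrix.sub_mul, Matrix.mul_one, Matrix.mul_assoc]
    have e2 : frobSq (Q * M * H) = ((M * H)ᵀ * Q * (M * H)).trace := by
      rw [frobSq_eq_trace]
      congr 1
      calc (Q * M * H)ᵀ * (Q * M * H) = (M * H)ᵀ * (Q * Q) * (M * H) := by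
            simp only [Matrix.transpose_mul, hQt, Matrix.mul_assoc]
        _ = _ := by rw [hQ]
    rw [e1, e2, trace_transpose_mul_mul, trace_transpose_mul_mul, Finset.mul_sum]
    exact (Finset.abs_sum_le_sum_abs _ _).trans (Finset.sum_le_sum fun b _ => ha _)
  -- The tail is split on the right, by `P`: its total mass goes into the shift.
  have htail : frobSq (Sᵀ * (N * M * H)) = frobSq (Sᵀ * (N * M)) - frobSq (Sᵀ * (N * M) * P) := by
    rw [← Matrix.mul_assoc, hH, frobSq_mul_one_sub hPt hP]
  have htail' : frobSq (N * M * H) = frobSq (N * M) - frobSq (N * M * P) := by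
    rw [hH, frobSq_mul_one_sub hPt hP]
  -- The trace is cyclic and `H * H = H`, so one of the two projections `H` can be dropped.
  have hcross : |((Sᵀ * (Q * M * H))ᵀ * (Sᵀ * (N * M * H))).trace| ≤ √(frobSq (M * H)) * γ := by
    have e : ((Sᵀ * (Q * M * H))ᵀ * (Sᵀ * (N * M * H))).trace
        = ((Q * M * H)ᵀ * (Q * (S * Sᵀ) * (N * M))).trace := by
      have e1 : (Sᵀ * (Q * M * H))ᵀ * (Sᵀ * (N * M * H))
          = (H * Mᵀ * Q * S * Sᵀ * N * M) * H := by
        simp only [Matrix.transpose_mul, Matrix.transpose_transpose, hQt, hHt, Matrix.mul_assoc]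
      have e2 : (Q * M * H)ᵀ * (Q * (S * Sᵀ) * (N * M)) = H * Mᵀ * Q * S * Sᵀ * N * M := by
        calc _ = H * Mᵀ * (Q * Q) * S * Sᵀ * N * M := by
              simp only [Matrix.transpose_mul, hQt, hHt, Matrix.mul_assoc]
          _ = _ := by rw [hQ]
      rw [e1, e2, Matrix.trace_mul_comm]
      simp only [← Matrix.mul_assoc, hHH]
    rw [e]
    refine (abs_trace_transpose_mul_le _ _).trans ?_
    gcongr
    · linarith [frobSq_nonneg (N * M * H)]
    · exact Real.sqrt_le_iff.mpr ⟨hγ, hc⟩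
  rw [hsplitS, frobSq_add, htail]
  have h1 := frobSq_nonneg (N * M * P)
  have h2 := frobSq_nonneg (Sᵀ * (N * M) * P)
  have h3 : δ * frobSq (Q * M * H) ≤ δ * frobSq (M * H) := by
    gcongr
    linarith [frobSq_nonneg (N * M * H)]
  rw [abs_le] at hhead hcross ⊢
  constructor <;> nlinarith [hhead.1, hhead.2, hcross.1, hcross.2]

end

/-! ### Spectral truncation of a positive semidefinite matrix -/

/-- The orthogonal projection onto the eigenvectors of `conjDiag U σ` with eigenvalue above `a`. -/
noncomputable def headProj {n : ℕ} (U : Matrix (Fin n) (Fin n) ℝ) (σ : Fin n → ℝ) (a : ℝ) :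
    Matrix (Fin n) (Fin n) ℝ :=
  conjDiag U fun j => if a < σ j then 1 else 0

/-- `(A (A + a I)⁻¹)^(1/2)` for `A = conjDiag U σ`. The squared norms of its rows are the ridge
leverage scores of `A^(1/2)` with ridge `a`; a zero eigenvalue contributes `0` even if `a = 0`. -/
noncomputable def ridgeRoot {n : ℕ} (U : Matrix (Fin n) (Fin n) ℝ) (σ : Fin n → ℝ) (a : ℝ) :
    Matrix (Fin n) (Fin n) ℝ :=
  conjDiag U fun j => √(σ j / (σ j + a))

/-- The square root of the part of `conjDiag U σ` with eigenvalues at most `a`. -/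
noncomputable def tailRoot {n : ℕ} (U : Matrix (Fin n) (Fin n) ℝ) (σ : Fin n → ℝ) (a : ℝ) :
    Matrix (Fin n) (Fin n) ℝ :=
  conjDiag U fun j => if a < σ j then 0 else √(σ j)

section
variable {n k : ℕ} {U : Matrix (Fin n) (Fin n) ℝ} {σ : Fin n → ℝ} {a : ℝ}

theorem dotProduct_self_nonneg_real {m : ℕ} (v : Fin m → ℝ) : 0 ≤ v ⬝ᵥ v :=
  Finset.sum_nonneg fun _ _ => mul_self_nonneg _

theorem mulVec_dotProduct_mulVec {l m : ℕ} (X : Matrix (Fin l) (Fin m) ℝ) (v : Fin m → ℝ) :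
    (X *ᵥ v) ⬝ᵥ (X *ᵥ v) = v ⬝ᵥ (Xᵀ * X) *ᵥ v := by
  rw [Matrix.dotProduct_mulVec, ← Matrix.mulVec_transpose, Matrix.mulVec_mulVec, dotProduct_comm]

theorem transpose_mulVec_dotProduct_le {l m : ℕ} {X : Matrix (Fin l) (Fin m) ℝ} {c : ℝ}
    (hc : 0 ≤ c) (h : ∀ v, (X *ᵥ v) ⬝ᵥ (X *ᵥ v) ≤ c * (v ⬝ᵥ v)) (u : Fin l → ℝ) :
    (Xᵀ *ᵥ u) ⬝ᵥ (Xᵀ *ᵥ u) ≤ c * (u ⬝ᵥ u) := by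
  set w := Xᵀ *ᵥ u with hw
  have e : w ⬝ᵥ w = u ⬝ᵥ (X *ᵥ w) := by
    rw [Matrix.dotProduct_mulVec, ← Matrix.mulVec_transpose, Matrix.transpose_transpose,
      dotProduct_comm]
  have hcs : (u ⬝ᵥ (X *ᵥ w)) ^ 2 ≤ (u ⬝ᵥ u) * ((X *ᵥ w) ⬝ᵥ (X *ᵥ w)) := by
    have := Finset.sum_mul_sq_le_sq_mul_sq Finset.univ u (X *ᵥ w)
    simpa only [dotProduct, sq] using this
  rw [← e] at hcs
  have hu := dotProduct_self_nonneg_real u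
  have h2 := mul_le_mul_of_nonneg_left (h w) hu
  rcases (dotProduct_self_nonneg_real w).eq_or_lt with h0 | h0
  · rw [← h0]; positivity
  · nlinarith

theorem conjDiag_mulVec_dotProduct_le (hU : Uᵀ * U = 1) {d : Fin n → ℝ} {c : ℝ}
    (h : ∀ j, d j * d j ≤ c) (v : Fin n → ℝ) :
    (conjDiag U d *ᵥ v) ⬝ᵥ (conjDiag U d *ᵥ v) ≤ c * (v ⬝ᵥ v) := by
  rw [mulVec_dotProduct_mulVec, conjDiag_transpose, conjDiag_mul hU]
  exact dotProduct_conjDiag_mulVec_le hU h v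

theorem headProj_transpose : (headProj U σ a)ᵀ = headProj U σ a := conjDiag_transpose _

theorem headProj_mul_self (hU : Uᵀ * U = 1) : headProj U σ a * headProj U σ a = headProj U σ a := by
  rw [headProj, conjDiag_mul hU]
  congr 1; funext j; split_ifs <;> simp

theorem one_sub_headProj (hU : Uᵀ * U = 1) :
    1 - headProj U σ a = conjDiag U fun j => if a < σ j then 0 else 1 := by
  rw [headProj, ← conjDiag_one hU, conjDiag_sub]
  congr 1; funext j; split_ifs <;> simp

theorem one_sub_headProj_mul (hU : Uᵀ * U = 1) :
    (1 - headProj U σ a) * conjDiag U σ = conjDiag U fun j => if a < σ j then 0 else σ j := by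
  rw [one_sub_headProj hU, conjDiag_mul hU]
  congr 1; funext j; split_ifs <;> simp

theorem tailRoot_mul_self (hU : Uᵀ * U = 1) (hσ : ∀ j, 0 ≤ σ j) :
    tailRoot U σ a * tailRoot U σ a = (1 - headProj U σ a) * conjDiag U σ := by
  rw [one_sub_headProj_mul hU, tailRoot, conjDiag_mul hU]
  congr 1; funext j; split_ifs
  · simp
  · exact Real.mul_self_sqrt (hσ j)

/-- A projection of rank at most `k` captures at most `k a²` of the part of the spectrum below
`a`. -/
theorem frobSq_tail_le (hU : Uᵀ * U = 1) (hσ : ∀ j, 0 ≤ σ j) (ha : 0 ≤ a) :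
    frobSq ((1 - headProj U σ a) * conjDiag U σ) ≤ tailSq (conjDiag U σ) k + k * a ^ 2 := by
  rw [← sub_le_iff_le_add]
  refine le_tailSq fun W hWt hW hr => ?_
  have hNt : (1 - headProj U σ a)ᵀ = 1 - headProj U σ a := by
    rw [Matrix.transpose_sub, Matrix.transpose_one, headProj_transpose]
  have hNN : (1 - headProj U σ a) * (1 - headProj U σ a) = 1 - headProj U σ a := by
    rw [Matrix.mul_sub, Matrix.sub_mul, Matrix.sub_mul, headProj_mul_self hU]; simp
  have h1 := frobSq_proj_mul_le hNt hNN (conjDiag U σ * (1 - W))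
  rw [← Matrix.mul_assoc, frobSq_mul_one_sub hWt hW] at h1
  have h2 : frobSq ((1 - headProj U σ a) * conjDiag U σ * W) ≤ a ^ 2 * frobSq W := by
    rw [one_sub_headProj_mul hU]
    refine frobSq_mul_le_of_norm_le (conjDiag_mulVec_dotProduct_le hU fun j => ?_) W
    split_ifs with h
    · nlinarith
    · push Not at h; nlinarith [hσ j]
  rw [frobSq_proj_eq_rank hWt hW] at h2
  have h3 : (W.rank : ℝ) ≤ k := by exact_mod_cast hr
  nlinarith [sq_nonneg a]

/-- The number of eigenvalues above `a` exceeds `k` by at most `‖A - A_k‖_F² / a²`. -/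
theorem sq_mul_rank_headProj_sub_le (hU : Uᵀ * U = 1) (ha : 0 ≤ a) :
    a ^ 2 * ((headProj U σ a).rank - k) ≤ tailSq (conjDiag U σ) k := by
  refine le_tailSq fun W hWt hW hr => ?_
  have hQt := headProj_transpose (U := U) (σ := σ) (a := a)
  have hQ := headProj_mul_self (σ := σ) (a := a) hU
  have h1 := frobSq_proj_mul_le hQt hQ (conjDiag U σ * (1 - W))
  have h2 : a ^ 2 * frobSq (headProj U σ a * (1 - W))
      ≤ frobSq (headProj U σ a * (conjDiag U σ * (1 - W))) := by
    rcases ha.eq_or_lt with h0 | h0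
    · rw [← h0]; simpa using frobSq_nonneg _
    have h := frobSq_mul_le_of_quadForm_le (X := headProj U σ a)
      (Y := headProj U σ a * conjDiag U σ) (c := (a ^ 2)⁻¹) (fun v => ?_) (1 - W)
    · rw [← Matrix.mul_assoc]
      rwa [inv_mul_eq_div, le_div_iff₀ (by positivity), mul_comm] at h
    · rw [mulVec_dotProduct_mulVec, mulVec_dotProduct_mulVec, hQt, hQ, headProj, conjDiag_mul hU,
        conjDiag_transpose, conjDiag_mul hU, dotProduct_conjDiag_mulVec,
        dotProduct_conjDiag_mulVec, Finset.mul_sum]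
      refine Finset.sum_le_sum fun j _ => ?_
      rw [← mul_assoc]
      refine mul_le_mul_of_nonneg_right ?_ (sq_nonneg _)
      split_ifs with h
      · rw [inv_mul_eq_div, le_div_iff₀ (by positivity)]
        nlinarith
      · simp
  rw [frobSq_mul_one_sub hWt hW, frobSq_proj_eq_rank hQt hQ] at h2
  have h3 := frobSq_proj_mul_le hQt hQ W
  rw [frobSq_proj_eq_rank hWt hW] at h3
  have h4 : (W.rank : ℝ) ≤ k := by exact_mod_cast hr
  nlinarith [sq_nonneg a]

open Filter Topology in
/-- The case `a = 0`, in which the bound of `sq_mul_rank_headProj_sub_le` is void. -/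
theorem rank_headProj_zero_le (hU : Uᵀ * U = 1) (hT : tailSq (conjDiag U σ) k = 0) :
    (headProj U σ 0).rank ≤ k := by
  -- A threshold below every positive eigenvalue gives the same projection.
  have hev : ∀ᶠ b in 𝓝[>] (0 : ℝ), ∀ j, 0 < σ j → b < σ j := by
    refine eventually_all.mpr fun j => ?_
    by_cases h : 0 < σ j
    · filter_upwards [Ioo_mem_nhdsGT h] with b hb _ using hb.2
    · exact Eventually.of_forall fun b hb => absurd hb h
  obtain ⟨b, hb, hb0⟩ := (hev.and self_mem_nhdsWithin).exists
  have hb0 : 0 < b := hb0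
  have e : headProj U σ 0 = headProj U σ b := by
    unfold headProj
    congr 1; funext j
    have : (0 < σ j) ↔ b < σ j := ⟨hb j, hb0.trans⟩
    simp only [this]
  have := sq_mul_rank_headProj_sub_le (k := k) (σ := σ) hU hb0.le
  rw [hT, ← e] at this
  have h2 : ((headProj U σ 0).rank : ℝ) ≤ k := by
    by_contra hcon
    push Not at hcon
    have : 0 < b ^ 2 * ((headProj U σ 0).rank - k) := mul_pos (by positivity) (by linarith)
    linarith
  exact_mod_cast h2

/-! ### Ridge leverage scores of the square root -/

theorem cfcSqrt_conjDiag (hU : Uᵀ * U = 1) (hσ : ∀ j, 0 ≤ σ j) :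
    CFC.sqrt (conjDiag U σ) = conjDiag U fun j => √(σ j) := by
  refine CFC.sqrt_unique ?_ ?_
  · rw [conjDiag_mul hU]
    congr 1; funext j; exact Real.mul_self_sqrt (hσ j)
  · rw [Matrix.nonneg_iff_posSemidef]
    refine Matrix.PosSemidef.of_dotProduct_mulVec_nonneg ?_ fun v => ?_
    · rw [Matrix.IsHermitian, Matrix.conjTranspose_eq_transpose_of_trivial, conjDiag_transpose]
    · rw [star_trivial, dotProduct_conjDiag_mulVec]
      exact Finset.sum_nonneg fun j _ => mul_nonneg (Real.sqrt_nonneg _) (sq_nonneg _)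

theorem pinv_conjDiag (hU : Uᵀ * U = 1) (d : Fin n → ℝ) :
    pinv (conjDiag U d) = conjDiag U fun j => (d j)⁻¹ := by
  refine (isMoorePenrose_pinv _).unique ⟨?_, ?_, ?_, ?_⟩
  · rw [conjDiag_mul hU, conjDiag_mul hU]
    congr 1; funext j; exact mul_inv_mul_cancel _
  · rw [conjDiag_mul hU, conjDiag_mul hU]
    congr 1; funext j
    by_cases h : d j = 0 <;> simp [h]
  · rw [conjDiag_mul hU, conjDiag_transpose]
  · rw [conjDiag_mul hU, conjDiag_transpose]

theorem ridgeScore_sqrt_conjDiag (hU : Uᵀ * U = 1) (hσ : ∀ j, 0 ≤ σ j) (k : ℕ) (i : Fin n) :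
    ridgeScore k (CFC.sqrt (conjDiag U σ)) i
      = ∑ j, σ j / (σ j + tailSq (CFC.sqrt (conjDiag U σ)) k / k) * U i j ^ 2 := by
  rw [ridgeScore]
  set b := tailSq (CFC.sqrt (conjDiag U σ)) k / k
  set R : Matrix (Fin n) (Fin n) ℝ := conjDiag U fun j => √(σ j) with hR
  have hRt : Rᵀ = R := conjDiag_transpose _
  rw [cfcSqrt_conjDiag hU hσ, ← hR]
  have hsum : R * Rᵀ + b • (1 : Matrix (Fin n) (Fin n) ℝ) = conjDiag U fun j => σ j + b := by
    rw [hRt, hR, conjDiag_mul hU, ← conjDiag_one hU, conjDiag_smul, conjDiag_add]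
    congr 1; funext j; rw [Real.mul_self_sqrt (hσ j), mul_one]
  rw [hsum, pinv_conjDiag hU]
  have e : R.col i ⬝ᵥ (conjDiag U fun j => (σ j + b)⁻¹) *ᵥ R.col i
      = (Rᵀ * (conjDiag U fun j => (σ j + b)⁻¹) * R) i i := by
    rw [Matrix.mul_assoc]; rfl
  rw [e, hRt, hR, conjDiag_mul hU, conjDiag_mul hU, conjDiag_diag]
  refine Finset.sum_congr rfl fun j _ => ?_
  linear_combination ((σ j + b)⁻¹ * U i j ^ 2) * Real.mul_self_sqrt (hσ j)

/-- Truncating `A^(1/2)` at the eigenvalues of `A` above `a` leaves the trace of the tail of `A`,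
which Cauchy–Schwarz compares with the Frobenius norm of that tail. -/
theorem tailSq_sqrt_le (hU : Uᵀ * U = 1) (hσ : ∀ j, 0 ≤ σ j) (hr : (headProj U σ a).rank ≤ k) :
    tailSq (CFC.sqrt (conjDiag U σ)) k
      ≤ √(n * frobSq ((1 - headProj U σ a) * conjDiag U σ)) := by
  have hB : (headProj U σ a * CFC.sqrt (conjDiag U σ)).rank ≤ k :=
    (Matrix.rank_mul_le_left _ _).trans hr
  refine (tailSq_le hB).trans (Real.le_sqrt_of_sq_le ?_)
  have e : CFC.sqrt (conjDiag U σ) - headProj U σ a * CFC.sqrt (conjDiag U σ) = tailRoot U σ a := by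
    rw [cfcSqrt_conjDiag hU hσ, headProj, conjDiag_mul hU, conjDiag_sub, tailRoot]
    congr 1; funext j; split_ifs <;> simp
  have e1 : frobSq (tailRoot U σ a) = ∑ j, if a < σ j then 0 else σ j := by
    rw [frobSq_eq_trace, tailRoot, conjDiag_transpose, ← tailRoot, tailRoot_mul_self hU hσ,
      one_sub_headProj_mul hU, trace_conjDiag hU]
  have e2 : frobSq ((1 - headProj U σ a) * conjDiag U σ)
      = ∑ j, (if a < σ j then 0 else σ j) ^ 2 := by
    rw [one_sub_headProj_mul hU, frobSq_eq_trace, conjDiag_transpose, conjDiag_mul hU,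
      trace_conjDiag hU]
    exact Finset.sum_congr rfl fun j _ => (sq _).symm
  rw [e, e1, e2]
  have := sq_sum_le_card_mul_sum_sq (s := (Finset.univ : Finset (Fin n)))
    (f := fun j => if a < σ j then 0 else σ j)
  simpa using this

theorem ridgeRoot_mul_self (hU : Uᵀ * U = 1) (hσ : ∀ j, 0 ≤ σ j) (ha : 0 ≤ a) :
    ridgeRoot U σ a * ridgeRoot U σ a = conjDiag U fun j => σ j / (σ j + a) := by
  rw [ridgeRoot, conjDiag_mul hU]
  congr 1; funext j
  exact Real.mul_self_sqrt (div_nonneg (hσ j) (add_nonneg (hσ j) ha))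

/-- Oversampling by a factor `R ≥ 1` lowers the ridge parameter by the same factor. -/
theorem ridgeRoot_diag_le (hU : Uᵀ * U = 1) (hσ : ∀ j, 0 ≤ σ j) (ha : 0 ≤ a) {R : ℝ} (hR : 1 ≤ R)
    (hk : tailSq (CFC.sqrt (conjDiag U σ)) k / k ≤ R * a) (i : Fin n) :
    (ridgeRoot U σ a * ridgeRoot U σ a) i i ≤ R * ridgeScore k (CFC.sqrt (conjDiag U σ)) i := by
  rw [ridgeRoot_mul_self hU hσ ha, conjDiag_diag, ridgeScore_sqrt_conjDiag hU hσ, Finset.mul_sum]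
  set b := tailSq (CFC.sqrt (conjDiag U σ)) k / k with hb
  have hb0 : 0 ≤ b := div_nonneg (tailSq_nonneg _ _) (Nat.cast_nonneg _)
  refine Finset.sum_le_sum fun j _ => ?_
  rw [← mul_assoc]
  refine mul_le_mul_of_nonneg_right ?_ (sq_nonneg _)
  rcases (hσ j).eq_or_lt with h | h
  · rw [← h]; simp
  · rw [← mul_div_assoc, div_le_div_iff₀ (by linarith) (by linarith)]
    have : σ j + b ≤ R * (σ j + a) := by nlinarith
    nlinarith

theorem ridgeRoot_transpose : (ridgeRoot U σ a)ᵀ = ridgeRoot U σ a := conjDiag_transpose _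

theorem quadForm_ridgeRoot_le (hU : Uᵀ * U = 1) (hσ : ∀ j, 0 ≤ σ j) (ha : 0 ≤ a) (v : Fin n → ℝ) :
    v ⬝ᵥ (ridgeRoot U σ a * ridgeRoot U σ a) *ᵥ v ≤ v ⬝ᵥ v := by
  rw [ridgeRoot_mul_self hU hσ ha]
  refine (dotProduct_conjDiag_mulVec_le hU (c := 1) (fun j => ?_) v).trans_eq (one_mul _)
  exact div_le_one_of_le₀ (by linarith) (add_nonneg (hσ j) ha)

theorem sum_headProj_sq_le (hU : Uᵀ * U = 1) (hσ : ∀ j, 0 ≤ σ j) (ha : 0 ≤ a) (i : Fin n) :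
    ∑ b, headProj U σ a b i ^ 2 ≤ 2 * (ridgeRoot U σ a * ridgeRoot U σ a) i i := by
  have e : ∑ b, headProj U σ a b i ^ 2 = headProj U σ a i i := by
    conv_rhs => rw [← headProj_mul_self hU]
    conv_rhs => arg 1; rw [← headProj_transpose]
    rw [Matrix.mul_apply]
    exact Finset.sum_congr rfl fun b _ => sq _
  rw [e, ridgeRoot_mul_self hU hσ ha, headProj, conjDiag_diag, conjDiag_diag, Finset.mul_sum]
  refine Finset.sum_le_sum fun j _ => ?_
  rw [← mul_assoc]
  refine mul_le_mul_of_nonneg_right ?_ (sq_nonneg _)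
  split_ifs with h
  · rw [← mul_div_assoc, le_div_iff₀ (by linarith)]; linarith
  · exact mul_nonneg two_pos.le (div_nonneg (hσ j) (add_nonneg (hσ j) ha))

theorem sum_tail_sq_le (hU : Uᵀ * U = 1) (hσ : ∀ j, 0 ≤ σ j) (ha : 0 ≤ a) (i : Fin n) :
    ∑ b, ((1 - headProj U σ a) * conjDiag U σ) i b ^ 2
      ≤ 2 * a ^ 2 * (ridgeRoot U σ a * ridgeRoot U σ a) i i := by
  rw [one_sub_headProj_mul hU]
  set d : Fin n → ℝ := fun j => if a < σ j then 0 else σ j with hd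
  have e : ∑ b, conjDiag U d i b ^ 2 = (conjDiag U d * (conjDiag U d)ᵀ) i i := by
    rw [Matrix.mul_apply]
    exact Finset.sum_congr rfl fun b _ => sq _
  rw [e, conjDiag_transpose, conjDiag_mul hU, ridgeRoot_mul_self hU hσ ha, conjDiag_diag,
    conjDiag_diag, Finset.mul_sum]
  refine Finset.sum_le_sum fun j _ => ?_
  rw [← mul_assoc]
  refine mul_le_mul_of_nonneg_right ?_ (sq_nonneg _)
  simp only [hd]
  split_ifs with h
  · have := div_nonneg (hσ j) (add_nonneg (hσ j) ha)
    simpa using mul_nonneg (mul_nonneg two_pos.le (sq_nonneg a)) this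
  · push Not at h
    rcases (hσ j).eq_or_lt with h0 | h0
    · rw [← h0]; simp
    · rw [← mul_div_assoc, le_div_iff₀ (by linarith)]
      have : σ j * (σ j + a) ≤ 2 * a ^ 2 := by nlinarith
      nlinarith

/-! ### Consequences of spectral approximation -/

section
variable {t : ℕ} {S : Matrix (Fin n) (Fin t) ℝ} {δ : ℝ}

/-- On the head, `ridgeRoot` is invertible with inverse at most `√2`, so the spectral
approximation passes to the projection itself. -/
theorem abs_quadForm_headProj_le (hU : Uᵀ * U = 1) (ha : 0 ≤ a) (hδ : 0 ≤ δ)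
    (hS : ∀ v, |v ⬝ᵥ (ridgeRoot U σ a * (S * Sᵀ - 1) * ridgeRoot U σ a) *ᵥ v| ≤ δ * (v ⬝ᵥ v))
    (v : Fin n → ℝ) :
    |v ⬝ᵥ (headProj U σ a * (S * Sᵀ - 1) * headProj U σ a) *ᵥ v|
      ≤ 2 * δ * (v ⬝ᵥ headProj U σ a *ᵥ v) := by
  set G : Matrix (Fin n) (Fin n) ℝ :=
    conjDiag U fun j => if a < σ j then √((σ j + a) / σ j) else 0 with hG
  have hGt : Gᵀ = G := conjDiag_transpose _
  have hcancel : ∀ j, a < σ j → √(σ j / (σ j + a)) * √((σ j + a) / σ j) = 1 := fun j h => by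
    have : 0 < σ j := by linarith
    rw [← Real.sqrt_mul (by positivity), div_mul_div_cancel₀ (by positivity), div_self this.ne',
      Real.sqrt_one]
  have hBG : ridgeRoot U σ a * G = headProj U σ a := by
    rw [ridgeRoot, hG, conjDiag_mul hU, headProj]
    congr 1; funext j
    split_ifs with h
    · exact hcancel j h
    · simp
  have hGB : G * ridgeRoot U σ a = headProj U σ a := by
    have := congrArg Matrix.transpose hBG
    rwa [Matrix.transpose_mul, hGt, ridgeRoot_transpose, headProj_transpose] at this
  have e : v ⬝ᵥ (headProj U σ a * (S * Sᵀ - 1) * headProj U σ a) *ᵥ v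
      = (G *ᵥ v) ⬝ᵥ (ridgeRoot U σ a * (S * Sᵀ - 1) * ridgeRoot U σ a) *ᵥ (G *ᵥ v) := by
    have h : headProj U σ a * (S * Sᵀ - 1) * headProj U σ a
        = Gᵀ * (ridgeRoot U σ a * (S * Sᵀ - 1) * ridgeRoot U σ a) * G := by
      calc _ = (G * ridgeRoot U σ a) * (S * Sᵀ - 1) * (ridgeRoot U σ a * G) := by rw [hGB, hBG]
        _ = _ := by rw [hGt]; simp only [Matrix.mul_assoc]
    rw [h, ← Matrix.mulVec_mulVec, ← Matrix.mulVec_mulVec, Matrix.dotProduct_mulVec,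
      ← Matrix.mulVec_transpose, Matrix.transpose_transpose]
  rw [e]
  refine (hS _).trans ?_
  rw [mul_comm 2 δ, mul_assoc]
  refine mul_le_mul_of_nonneg_left ?_ hδ
  rw [mulVec_dotProduct_mulVec, hGt, hG, conjDiag_mul hU, headProj, dotProduct_conjDiag_mulVec,
    dotProduct_conjDiag_mulVec, Finset.mul_sum]
  refine Finset.sum_le_sum fun j _ => ?_
  rw [← mul_assoc]
  refine mul_le_mul_of_nonneg_right ?_ (sq_nonneg _)
  split_ifs with h
  · have : 0 < σ j := by linarith
    rw [Real.mul_self_sqrt (by positivity), div_le_iff₀ this]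
    linarith
  · simp

/-- Below the threshold `a`, the square root of `A` is `ridgeRoot` times a factor of squared norm at
most `2 a`. -/
theorem sketch_tailRoot_le (hU : Uᵀ * U = 1) (hσ : ∀ j, 0 ≤ σ j) (ha : 0 ≤ a) (hδ : δ ≤ 1)
    (hS : ∀ v, |v ⬝ᵥ (ridgeRoot U σ a * (S * Sᵀ - 1) * ridgeRoot U σ a) *ᵥ v| ≤ δ * (v ⬝ᵥ v))
    (v : Fin n → ℝ) :
    ((Sᵀ * tailRoot U σ a) *ᵥ v) ⬝ᵥ ((Sᵀ * tailRoot U σ a) *ᵥ v) ≤ 4 * a * (v ⬝ᵥ v) := by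
  set G : Matrix (Fin n) (Fin n) ℝ :=
    conjDiag U fun j => if a < σ j then 0 else √(σ j + a) with hG
  have hBG : ridgeRoot U σ a * G = tailRoot U σ a := by
    rw [ridgeRoot, hG, conjDiag_mul hU, tailRoot]
    congr 1; funext j
    split_ifs with h
    · simp
    · rcases (hσ j).eq_or_lt with h0 | h0
      · rw [← h0]; simp
      · rw [← Real.sqrt_mul (by positivity), div_mul_cancel₀ _ (by positivity)]
  have e : ((Sᵀ * tailRoot U σ a) *ᵥ v) ⬝ᵥ ((Sᵀ * tailRoot U σ a) *ᵥ v)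
      = (G *ᵥ v) ⬝ᵥ (ridgeRoot U σ a * (S * Sᵀ - 1) * ridgeRoot U σ a) *ᵥ (G *ᵥ v)
        + (G *ᵥ v) ⬝ᵥ (ridgeRoot U σ a * ridgeRoot U σ a) *ᵥ (G *ᵥ v) := by
    rw [← dotProduct_add, ← Matrix.add_mulVec, ← Matrix.add_mul, Matrix.mul_sub, Matrix.mul_one,
      sub_add_cancel, ← hBG, ← Matrix.mul_assoc, ← Matrix.mulVec_mulVec, mulVec_dotProduct_mulVec,
      Matrix.transpose_mul, Matrix.transpose_transpose, ridgeRoot_transpose]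
    simp only [Matrix.mul_assoc]
  rw [e]
  have h1 := (abs_le.mp (hS (G *ᵥ v))).2
  have h2 := quadForm_ridgeRoot_le hU hσ ha (G *ᵥ v)
  have h3 : (G *ᵥ v) ⬝ᵥ (G *ᵥ v) ≤ 2 * a * (v ⬝ᵥ v) := by
    refine conjDiag_mulVec_dotProduct_le hU (fun j => ?_) v
    split_ifs with h
    · simpa using ha
    · rw [Real.mul_self_sqrt (add_nonneg (hσ j) ha)]; linarith
  have h4 := dotProduct_self_nonneg_real (G *ᵥ v)
  nlinarith

theorem tailRoot_transpose : (tailRoot U σ a)ᵀ = tailRoot U σ a := conjDiag_transpose _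

theorem tailRoot_mulVec_le (hU : Uᵀ * U = 1) (hσ : ∀ j, 0 ≤ σ j) (ha : 0 ≤ a) (v : Fin n → ℝ) :
    (tailRoot U σ a *ᵥ v) ⬝ᵥ (tailRoot U σ a *ᵥ v) ≤ a * (v ⬝ᵥ v) := by
  refine conjDiag_mulVec_dotProduct_le hU (fun j => ?_) v
  split_ifs with h
  · simpa using ha
  · rw [Real.mul_self_sqrt (hσ j)]; linarith

end

end

/-! ### The row sketch preserves projection costs -/

section
variable {n t k : ℕ} {U : Matrix (Fin n) (Fin n) ℝ} {σ : Fin n → ℝ} {a ε : ℝ}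

/-- Column sampling keeps a constant fraction of `‖A - A_k‖_F²` outside every `k`-dimensional
subspace. The sketch guarantee is applied to `A` itself, with the projection onto the column space
of `A * S * P`. -/
theorem tailSq_le_four_mul_frobSq (hU : Uᵀ * U = 1) (hσ : ∀ j, 0 ≤ σ j) (ha : 0 ≤ a)
    (hε0 : 0 < ε) (hε : ε ≤ 1) (hka : k * a ^ 2 = ε * tailSq (conjDiag U σ) k / 256)
    {S : Matrix (Fin n) (Fin t) ℝ}
    (hS : ∀ v, |v ⬝ᵥ (ridgeRoot U σ a * (S * Sᵀ - 1) * ridgeRoot U σ a) *ᵥ v|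
      ≤ ε / 16 * (v ⬝ᵥ v))
    (hc : frobSq (headProj U σ a * (S * Sᵀ) * ((1 - headProj U σ a) * conjDiag U σ))
      ≤ ε ^ 2 * tailSq (conjDiag U σ) k / 256)
    (hd : (frobSq (Sᵀ * ((1 - headProj U σ a) * conjDiag U σ))
      - frobSq ((1 - headProj U σ a) * conjDiag U σ)) ^ 2 ≤ (tailSq (conjDiag U σ) k / 8) ^ 2)
    {P : Matrix (Fin t) (Fin t) ℝ} (hPr : P.rank ≤ k) :
    tailSq (conjDiag U σ) k ≤ 4 * frobSq (conjDiag U σ * S * (1 - P)) := by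
  set A := conjDiag U σ with hA
  set Q := headProj U σ a with hQ
  set T := tailSq A k with hT
  have hT0 : 0 ≤ T := tailSq_nonneg _ _
  have hAt : Aᵀ = A := conjDiag_transpose _
  obtain ⟨W, hWt, hW, hWr, hWC⟩ := exists_proj_mul_eq (A * S * P)
  have hWk : W.rank ≤ k := hWr.trans ((Matrix.rank_mul_le_right _ _).trans hPr)
  have hWk' : (W.rank : ℝ) ≤ k := by exact_mod_cast hWk
  have hfW : frobSq W ≤ k := by rwa [frobSq_proj_eq_rank hWt hW]
  set x := frobSq (A * (1 - W)) with hx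
  have hxT : T ≤ x := by
    have : A * (1 - W) = A - A * W := by rw [Matrix.mul_sub, Matrix.mul_one]
    rw [hx, this]
    exact tailSq_le ((Matrix.rank_mul_le_right _ _).trans hWk)
  have hy : frobSq (Sᵀ * A * (1 - W)) ≤ frobSq (A * S * (1 - P)) := by
    have h1Wt : (1 - W)ᵀ = 1 - W := by rw [Matrix.transpose_sub, Matrix.transpose_one, hWt]
    have h1W : (1 - W) * (1 - W) = 1 - W := by
      rw [Matrix.mul_sub, Matrix.sub_mul, Matrix.sub_mul, hW]; simp
    have h := frobSq_proj_mul_le h1Wt h1W (A * S * (1 - P))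
    have e : (1 - W) * (A * S * (1 - P)) = (Sᵀ * A * (1 - W))ᵀ := by
      have e0 : (1 - W) * (A * S * P) = 0 := by
        rw [Matrix.sub_mul, hWC, Matrix.one_mul, sub_self]
      rw [Matrix.mul_sub (A * S), Matrix.mul_sub, e0, Matrix.mul_one, sub_zero,
        Matrix.transpose_mul, Matrix.transpose_mul, Matrix.transpose_transpose, hAt, h1Wt]
    rwa [e, frobSq_transpose] at h
  have hNA : (1 - Q) * A = tailRoot U σ a * tailRoot U σ a := (tailRoot_mul_self hU hσ).symm
  -- On the range of a rank-`k` projection the tail has mass at most `k` times its squared norm.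
  have hb : frobSq ((1 - Q) * A * W) ≤ 4 * (k * a ^ 2) := by
    have h := frobSq_mul_le_of_norm_le (c := a * a) (X := (1 - Q) * A) (fun v => by
      rw [hNA, ← Matrix.mulVec_mulVec, mul_assoc]
      exact (tailRoot_mulVec_le hU hσ ha _).trans
        (mul_le_mul_of_nonneg_left (tailRoot_mulVec_le hU hσ ha v) ha)) W
    nlinarith [sq_nonneg a]
  have hb' : frobSq (Sᵀ * ((1 - Q) * A) * W) ≤ 4 * (k * a ^ 2) := by
    have h := frobSq_mul_le_of_norm_le (c := 4 * a * a) (X := Sᵀ * ((1 - Q) * A)) (fun v => by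
      rw [hNA, ← Matrix.mul_assoc, ← Matrix.mulVec_mulVec, mul_assoc]
      exact (sketch_tailRoot_le hU hσ ha (by linarith) hS _).trans
        (mul_le_mul_of_nonneg_left (tailRoot_mulVec_le hU hσ ha v) (by linarith))) W
    nlinarith [sq_nonneg a]
  have hsT : √T ^ 2 = T := Real.sq_sqrt hT0
  have hcore := abs_frobSq_sketch_add_sub_le S A headProj_transpose (headProj_mul_self hU) hWt hW
    (by positivity) (abs_quadForm_headProj_le hU ha (by positivity) hS) hb hb'
    (γ := ε / 16 * √T) (by positivity) (by rw [mul_pow, hsT]; linarith)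
  have hD := abs_le_of_sq_le_sq hd (by positivity)
  have hx0 : 0 ≤ x := hT0.trans hxT
  have hsx : √x ^ 2 = x := Real.sq_sqrt hx0
  have hsTx : √T * √x ≤ x := by
    have : √T ≤ √x := Real.sqrt_le_sqrt hxT
    nlinarith [Real.sqrt_nonneg x]
  have h1 : ε / 16 * √T * √x ≤ x / 16 := by
    rw [mul_assoc]
    nlinarith [mul_nonneg (Real.sqrt_nonneg T) (Real.sqrt_nonneg x)]
  have h2 : 2 * (ε / 16) * x ≤ x / 8 := by nlinarith
  have h3 : ε * T ≤ T := by nlinarith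
  have := abs_le.mp hcore
  have := abs_le.mp hD
  linarith

/-- If both samples are spectral approximations, the cross terms are small, and the tail of `A` has
the expected mass after sampling, then the cost of every rank-`k` projection is preserved. -/
theorem exists_shift_of_good_samples (hU : Uᵀ * U = 1) (hσ : ∀ j, 0 ≤ σ j) (ha : 0 ≤ a)
    (hε0 : 0 < ε) (hε : ε ≤ 1)
    (hka : k * a ^ 2 = ε * tailSq (conjDiag U σ) k / 256) {S R : Matrix (Fin n) (Fin t) ℝ}
    (hS : ∀ v, |v ⬝ᵥ (ridgeRoot U σ a * (S * Sᵀ - 1) * ridgeRoot U σ a) *ᵥ v|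
      ≤ ε / 16 * (v ⬝ᵥ v))
    (hR : ∀ v, |v ⬝ᵥ (ridgeRoot U σ a * (R * Rᵀ - 1) * ridgeRoot U σ a) *ᵥ v|
      ≤ ε / 16 * (v ⬝ᵥ v))
    (hc : frobSq (headProj U σ a * (S * Sᵀ) * ((1 - headProj U σ a) * conjDiag U σ))
      ≤ ε ^ 2 * tailSq (conjDiag U σ) k / 256)
    (hc' : frobSq (headProj U σ a * (R * Rᵀ) * ((1 - headProj U σ a) * (conjDiag U σ * S)))
      ≤ ε ^ 2 * tailSq (conjDiag U σ) k / 256)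
    (hd : (frobSq (Sᵀ * ((1 - headProj U σ a) * conjDiag U σ))
      - frobSq ((1 - headProj U σ a) * conjDiag U σ)) ^ 2 ≤ (tailSq (conjDiag U σ) k / 8) ^ 2)
    (he : frobSq (Rᵀ * ((1 - headProj U σ a) * (conjDiag U σ * S)))
      ≤ 600 * tailSq (conjDiag U σ) k) :
    ∃ Δ : ℝ, |Δ| ≤ 600 * tailSq (conjDiag U σ) k ∧
      ∀ P : Matrix (Fin t) (Fin t) ℝ, IsOrthProjOfRank k P →
        (1 - ε) * frobSq (conjDiag U σ * S * (1 - P)) ≤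
          frobSq (Rᵀ * conjDiag U σ * S * (1 - P)) + Δ ∧
        frobSq (Rᵀ * conjDiag U σ * S * (1 - P)) + Δ ≤
          (1 + ε) * frobSq (conjDiag U σ * S * (1 - P)) := by
  have hlow := fun P => tailSq_le_four_mul_frobSq (P := P) hU hσ ha hε0 hε hka hS hc hd
  have htail := frobSq_tail_le (k := k) hU hσ ha
  set A := conjDiag U σ with hA
  set Q := headProj U σ a with hQ
  set T := tailSq A k with hT
  have hT0 : 0 ≤ T := tailSq_nonneg _ _
  have hAt : Aᵀ = A := conjDiag_transpose _
  have hεT : ε * T ≤ T := by nlinarith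
  have hNA : (1 - Q) * A = tailRoot U σ a * tailRoot U σ a := (tailRoot_mul_self hU hσ).symm
  have hNAt : ((1 - Q) * A)ᵀ = (1 - Q) * A := by
    rw [hNA, Matrix.transpose_mul, tailRoot_transpose]
  have hNC : frobSq ((1 - Q) * (A * S)) = frobSq (Sᵀ * ((1 - Q) * A)) := by
    rw [← frobSq_transpose, ← Matrix.mul_assoc, Matrix.transpose_mul, hNAt]
  refine ⟨frobSq ((1 - Q) * (A * S)) - frobSq (Rᵀ * ((1 - Q) * (A * S))), ?_, ?_⟩
  · have h1 := abs_le.mp (abs_le_of_sq_le_sq hd (by positivity))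
    have h2 := frobSq_nonneg (Rᵀ * ((1 - Q) * (A * S)))
    have h3 := frobSq_nonneg ((1 - Q) * (A * S))
    rw [abs_le]
    constructor <;> linarith [h1.1, h1.2]
  · rintro P ⟨hPt, hP, hPr⟩
    have hfP : frobSq P = k := by rw [frobSq_proj_eq_rank hPt hP, hPr]
    have hxT := hlow P hPr.le
    set x := frobSq (A * S * (1 - P)) with hx
    have hroot : ∀ v, ((tailRoot U σ a * S) *ᵥ v) ⬝ᵥ ((tailRoot U σ a * S) *ᵥ v)
        ≤ 4 * a * (v ⬝ᵥ v) := fun v => by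
      have := transpose_mulVec_dotProduct_le (by positivity)
        (sketch_tailRoot_le hU hσ ha (by linarith) hS) v
      rwa [Matrix.transpose_mul, Matrix.transpose_transpose, tailRoot_transpose] at this
    have hNAS : (1 - Q) * (A * S) = tailRoot U σ a * (tailRoot U σ a * S) := by
      rw [← Matrix.mul_assoc, hNA, Matrix.mul_assoc]
    have hb : frobSq ((1 - Q) * (A * S) * P) ≤ 16 * (k * a ^ 2) := by
      have h := frobSq_mul_le_of_norm_le (c := a * (4 * a)) (X := (1 - Q) * (A * S)) (fun v => by
        rw [hNAS, ← Matrix.mulVec_mulVec, mul_assoc]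
        exact (tailRoot_mulVec_le hU hσ ha _).trans (mul_le_mul_of_nonneg_left (hroot v) ha)) P
      rw [hfP] at h
      nlinarith [sq_nonneg a, mul_nonneg (Nat.cast_nonneg (α := ℝ) k) (sq_nonneg a)]
    have hb' : frobSq (Rᵀ * ((1 - Q) * (A * S)) * P) ≤ 16 * (k * a ^ 2) := by
      have h := frobSq_mul_le_of_norm_le (c := 4 * a * (4 * a)) (X := Rᵀ * ((1 - Q) * (A * S)))
        (fun v => by
          rw [hNAS, ← Matrix.mul_assoc, ← Matrix.mulVec_mulVec, mul_assoc]
          exact (sketch_tailRoot_le hU hσ ha (by linarith) hR _).trans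
            (mul_le_mul_of_nonneg_left (hroot v) (by linarith))) P
      rw [hfP] at h
      nlinarith
    have hsT : √T ^ 2 = T := Real.sq_sqrt hT0
    have hcore := abs_frobSq_sketch_add_sub_le R (A * S) headProj_transpose (headProj_mul_self hU)
      hPt hP (by positivity) (abs_quadForm_headProj_le hU ha (by positivity) hR) hb hb'
      (γ := ε / 16 * √T) (by positivity) (by rw [mul_pow, hsT]; linarith)
    rw [← Matrix.mul_assoc Rᵀ A S] at hcore
    have hx0 : 0 ≤ x := frobSq_nonneg _
    have hsTx : √T * √x ≤ 2 * x := by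
      have h4 : √T ≤ 2 * √x := by
        rw [Real.sqrt_le_left (by positivity), mul_pow, Real.sq_sqrt hx0]; linarith
      nlinarith [Real.sqrt_nonneg x, Real.sq_sqrt hx0]
    have h1 : ε / 16 * √T * √x ≤ ε * x / 8 := by
      rw [mul_assoc]
      nlinarith
    have h3 : ε * T ≤ 4 * (ε * x) := by nlinarith
    have h5 : 0 ≤ ε * x := by positivity
    have := abs_le.mp hcore
    constructor <;> linarith

end

/-! ### Pairs of independent samples -/

section
variable {α : Type*} [Fintype α] {p : α → ℝ} {t : ℕ}

open Classical in
/-- The probability of the event `E` for two independent samples of size `t` from `p`. -/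
noncomputable def pairProb (p : α → ℝ) (t : ℕ) (E : (Fin t → α) → (Fin t → α) → Prop) : ℝ :=
  sampleExp p t fun x => sampleExp p t fun y => if E x y then 1 else 0

theorem sampleExp_sampleExp_eq_sum (f : (Fin t → α) → (Fin t → α) → ℝ) :
    sampleExp p t (fun x => sampleExp p t (f x))
      = ∑ q : (Fin t → α) × (Fin t → α), (∏ j, p (q.1 j)) * (∏ j, p (q.2 j)) * f q.1 q.2 := by
  simp only [sampleExp, Fintype.sum_prod_type, Finset.mul_sum, mul_assoc]

theorem pairProb_mono (h0 : ∀ i, 0 ≤ p i) {E F : (Fin t → α) → (Fin t → α) → Prop}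
    (h : ∀ x y, E x y → F x y) : pairProb p t E ≤ pairProb p t F :=
  sampleExp_mono h0 fun x => sampleProb_mono h0 (h x)

theorem pairProb_or_le (h0 : ∀ i, 0 ≤ p i) (E F : (Fin t → α) → (Fin t → α) → Prop) :
    pairProb p t (fun x y => E x y ∨ F x y) ≤ pairProb p t E + pairProb p t F := by
  rw [pairProb, pairProb, pairProb, ← sampleExp_add]
  exact sampleExp_mono h0 fun x => sampleProb_or_le h0 _ _

theorem pairProb_left (h1 : ∑ i, p i = 1) (E : (Fin t → α) → Prop) :
    pairProb p t (fun x _ => E x) = sampleProb p t E := by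
  simp only [pairProb, sampleExp_const h1, sampleProb]

theorem pairProb_right (h1 : ∑ i, p i = 1) (E : (Fin t → α) → Prop) :
    pairProb p t (fun _ y => E y) = sampleProb p t E := by
  simp only [pairProb, sampleExp_const h1, sampleProb]

theorem pairProb_add_pairProb_not (h1 : ∑ i, p i = 1)
    (E : (Fin t → α) → (Fin t → α) → Prop) :
    pairProb p t E + pairProb p t (fun x y => ¬ E x y) = 1 := by
  rw [pairProb, pairProb, ← sampleExp_add]
  refine Eq.trans (congrArg _ (funext fun x => ?_)) (sampleExp_const h1 t 1)
  rw [← sampleExp_add]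
  refine Eq.trans (congrArg _ (funext fun y => ?_)) (sampleExp_const h1 t 1)
  by_cases h : E x y <;> simp [h]

/-- Markov's inequality in a form that stays true when the mean vanishes. -/
theorem pairProb_lt_le (h0 : ∀ i, 0 ≤ p i) {f : (Fin t → α) → (Fin t → α) → ℝ}
    (hf : ∀ x y, 0 ≤ f x y) {m c b : ℝ} (hc : 0 < c)
    (hm : sampleExp p t (fun x => sampleExp p t (f x)) ≤ m) (hb : c * m ≤ b) :
    pairProb p t (fun x y => b < f x y) ≤ c⁻¹ := by
  have hm0 : 0 ≤ m := (sampleExp_nonneg h0 fun x => sampleExp_nonneg h0 (hf x)).trans hm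
  rw [pairProb, sampleExp_sampleExp_eq_sum]
  rw [sampleExp_sampleExp_eq_sum] at hm
  have hw : ∀ q : (Fin t → α) × (Fin t → α), 0 ≤ (∏ j, p (q.1 j)) * (∏ j, p (q.2 j)) := fun q =>
    mul_nonneg (Finset.prod_nonneg fun _ _ => h0 _) (Finset.prod_nonneg fun _ _ => h0 _)
  rcases hm0.eq_or_lt with hz | hpos
  · refine (le_of_eq (Finset.sum_eq_zero fun q _ => ?_)).trans (inv_nonneg.mpr hc.le)
    have hq := (Finset.sum_eq_zero_iff_of_nonneg fun q _ => mul_nonneg (hw q) (hf q.1 q.2)).mp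
      (le_antisymm (hm.trans hz.symm.le)
        (Finset.sum_nonneg fun q _ => mul_nonneg (hw q) (hf q.1 q.2))) q (Finset.mem_univ q)
    rcases mul_eq_zero.mp hq with h | h
    · rw [h, zero_mul]
    · rw [if_neg, mul_zero]
      rw [h, not_lt]
      rw [← hz, mul_zero] at hb
      exact hb
  · have hbpos : 0 < c * m := by positivity
    have : ∀ q : (Fin t → α) × (Fin t → α), (∏ j, p (q.1 j)) * (∏ j, p (q.2 j)) *
        (if b < f q.1 q.2 then (1 : ℝ) else 0)
        ≤ (c * m)⁻¹ * ((∏ j, p (q.1 j)) * (∏ j, p (q.2 j)) * f q.1 q.2) := fun q => by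
      rw [mul_left_comm]
      refine mul_le_mul_of_nonneg_left ?_ (hw q)
      split_ifs with h
      · rw [inv_mul_eq_div, le_div_iff₀ hbpos]; linarith
      · exact mul_nonneg (inv_nonneg.mpr hbpos.le) (hf _ _)
    refine (Finset.sum_le_sum fun q _ => this q).trans ?_
    rw [← Finset.mul_sum]
    calc (c * m)⁻¹ * _ ≤ (c * m)⁻¹ * m := mul_le_mul_of_nonneg_left hm (inv_nonneg.mpr hbpos.le)
      _ = c⁻¹ := by field_simp

theorem measureReal_eq_pairProb {Ω : Type*} [MeasurableSpace Ω] (μ : Measure Ω)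
    [IsProbabilityMeasure μ] {n : ℕ} {p : Fin n → ℝ} (s₁ s₂ : Fin t → Ω → Fin n)
    (hm₁ : ∀ j, Measurable (s₁ j)) (hm₂ : ∀ j, Measurable (s₂ j))
    (hind : iIndepFun (Sum.elim s₁ s₂) μ) (hp₁ : ∀ j i, μ.real {ω | s₁ j ω = i} = p i)
    (hp₂ : ∀ j i, μ.real {ω | s₂ j ω = i} = p i)
    (E : (Fin t → Fin n) → (Fin t → Fin n) → Prop) :
    μ.real {ω | E (fun j => s₁ j ω) (fun j => s₂ j ω)} = pairProb p t E := by
  classical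
  set Z : Ω → (Fin t → Fin n) × (Fin t → Fin n) :=
    fun ω => (fun j => s₁ j ω, fun j => s₂ j ω) with hZ
  have hZm : Measurable Z :=
    (measurable_pi_lambda _ hm₁).prodMk (measurable_pi_lambda _ hm₂)
  have hpre : {ω | E (fun j => s₁ j ω) (fun j => s₂ j ω)}
      = Z ⁻¹' ↑(Finset.univ.filter fun q : (Fin t → Fin n) × (Fin t → Fin n) => E q.1 q.2) := by
    ext ω; simp [hZ]
  have hsing : ∀ q : (Fin t → Fin n) × (Fin t → Fin n),
      μ.real (Z ⁻¹' {q}) = (∏ j, p (q.1 j)) * (∏ j, p (q.2 j)) := by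
    intro q
    have hset : Z ⁻¹' {q} = ⋂ i : Fin t ⊕ Fin t,
        (Sum.elim s₁ s₂ i) ⁻¹' {Sum.elim q.1 q.2 i} := by
      ext ω
      simp [hZ, Prod.ext_iff, funext_iff]
    have h := hind.meas_iInter (s := fun i => (Sum.elim s₁ s₂ i) ⁻¹' {Sum.elim q.1 q.2 i})
      (fun i => ⟨{Sum.elim q.1 q.2 i}, measurableSet_singleton _, rfl⟩)
    rw [hset, measureReal_def, h, ENNReal.toReal_prod, Fintype.prod_sum_type]
    congr 1
    · exact Finset.prod_congr rfl fun j _ => hp₁ j (q.1 j)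
    · exact Finset.prod_congr rfl fun j _ => hp₂ j (q.2 j)
  rw [hpre, ← sum_measureReal_preimage_singleton _ fun q _ => hZm (measurableSet_singleton q),
    pairProb, sampleExp_sampleExp_eq_sum, Finset.sum_filter]
  refine Finset.sum_congr rfl fun q _ => ?_
  by_cases h : E q.1 q.2 <;> simp [h, hsing]

end

/-! ### Choice of parameters -/

section
variable {n k : ℕ} {ε : ℝ}

/-- With `k' ≥ 512 k / ε` the ridge parameter of the rank-`k'` scores of `A^(1/2)`, divided by the
oversampling factor `√(16 n ε / k)`, is at most the threshold `√(ε ‖A - A_k‖_F² / (256 k))`. -/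
theorem tailSq_sqrt_div_le {U : Matrix (Fin n) (Fin n) ℝ} {σ : Fin n → ℝ} {a : ℝ} {k' : ℕ}
    (hU : Uᵀ * U = 1) (hσ : ∀ j, 0 ≤ σ j) (ha : 0 ≤ a) (hk : 1 ≤ k) (hε0 : 0 < ε) (hε : ε ≤ 1)
    (hka : k * a ^ 2 = ε * tailSq (conjDiag U σ) k / 256) (hk' : 512 * k / ε ≤ k') :
    tailSq (CFC.sqrt (conjDiag U σ)) k' / k' ≤ √(16 * n * ε / k) * a := by
  have htail := frobSq_tail_le (k := k) hU hσ ha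
  have hrank := sq_mul_rank_headProj_sub_le (k := k) (σ := σ) hU ha
  have hzero := rank_headProj_zero_le (k := k) (σ := σ) hU
  set T := tailSq (conjDiag U σ) k with hT
  have hT0 : 0 ≤ T := tailSq_nonneg _ _
  have hk0 : (1 : ℝ) ≤ k := by exact_mod_cast hk
  have hkε : (k : ℝ) ≤ k / ε := by rw [le_div_iff₀ hε0]; nlinarith
  rw [mul_div_assoc] at hk'
  have hk'0 : (0 : ℝ) < k' := by linarith
  have hr : (headProj U σ a).rank ≤ k' := by
    have : ((headProj U σ a).rank : ℝ) ≤ k' := by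
      rcases hT0.eq_or_lt with h | h
      · have ha0 : a = 0 := by
          rw [← h, mul_zero, zero_div] at hka
          rcases mul_eq_zero.mp hka with h' | h'
          · linarith
          · exact pow_eq_zero_iff two_ne_zero |>.mp h'
        have := hzero h.symm
        rw [ha0]
        have h2 : ((headProj U σ 0).rank : ℝ) ≤ k := by exact_mod_cast this
        linarith
      · have ha2 : a ^ 2 = ε * T / (256 * k) := by
          field_simp at hka ⊢; linarith
        have h1 : ((headProj U σ a).rank : ℝ) - k ≤ 256 * (k / ε) := by
          rw [ha2] at hrank
          have hpos : 0 < ε * T / (256 * k) := by positivity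
          rw [mul_comm, ← le_div_iff₀ hpos] at hrank
          refine hrank.trans (le_of_eq ?_)
          field_simp
        linarith
    exact_mod_cast this
  have hfT : frobSq ((1 - headProj U σ a) * conjDiag U σ) ≤ 2 * T := by nlinarith
  rw [div_le_iff₀ hk'0]
  refine (tailSq_sqrt_le hU hσ hr).trans ?_
  have hn0 : (0 : ℝ) ≤ n := Nat.cast_nonneg n
  calc √(n * frobSq ((1 - headProj U σ a) * conjDiag U σ)) ≤ √(n * (2 * T)) := by gcongr
    _ ≤ √(16 * n * ε / k) * a * (512 * (k / ε)) := by
        rw [Real.sqrt_le_left (by positivity), mul_pow, mul_pow, Real.sq_sqrt (by positivity)]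
        have ha2 : a ^ 2 = ε * T / (256 * k) := by
          field_simp at hka ⊢; linarith
        rw [ha2]
        have : 16 * n * ε / k * (ε * T / (256 * k)) * (512 * (k / ε)) ^ 2 = 16384 * (n * T) := by
          field_simp; ring
        rw [this]
        nlinarith [mul_nonneg hn0 hT0]
    _ ≤ _ := by gcongr

theorem two_mul_card_mul_exp_le {c L : ℝ} (hn : 2 ≤ n) (hL0 : 0 < L)
    (hc : 2000000 ≤ c) (hL : L * (c * Real.log n) ≤ ε ^ 2) :
    2 * (n * Real.exp (-((ε / 16) ^ 2 / (4 * L)))) ≤ 1 / 1000 := by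
  have hn' : (2 : ℝ) ≤ n := by exact_mod_cast hn
  have hlog : 0 < Real.log n := Real.log_pos (by linarith)
  have h1 : 12 * Real.log n ≤ (ε / 16) ^ 2 / (4 * L) := by
    rw [le_div_iff₀ (by positivity)]
    nlinarith [mul_pos hL0 hlog]
  have h2 : Real.exp (-((ε / 16) ^ 2 / (4 * L))) ≤ ((n : ℝ) ^ 12)⁻¹ := by
    calc _ ≤ Real.exp (-(12 * Real.log n)) := Real.exp_le_exp.mpr (by linarith)
      _ = _ := by
        rw [Real.exp_neg, mul_comm, Real.exp_mul, Real.exp_log (by linarith)]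
        norm_cast
  have h3 : (n : ℝ) * ((n : ℝ) ^ 12)⁻¹ = ((n : ℝ) ^ 11)⁻¹ := by
    field_simp
  have h4 : ((n : ℝ) ^ 11)⁻¹ ≤ ((2 : ℝ) ^ 11)⁻¹ := by gcongr
  calc 2 * (n * Real.exp (-((ε / 16) ^ 2 / (4 * L)))) ≤ 2 * (n * ((n : ℝ) ^ 12)⁻¹) := by gcongr
    _ ≤ 2 * ((2 : ℝ) ^ 11)⁻¹ := by rw [h3]; gcongr
    _ ≤ _ := by norm_num

/-- The failure probability of the six conditions of `exists_shift_of_good_samples`. Here `L`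
bounds the squared norm of a sampled and rescaled row of `ridgeRoot U σ a`. -/
theorem pairProb_not_exists_shift_le {t : ℕ} {U : Matrix (Fin n) (Fin n) ℝ} {σ : Fin n → ℝ}
    {a : ℝ} {p : Fin n → ℝ} {c L : ℝ} (hU : Uᵀ * U = 1) (hσ : ∀ j, 0 ≤ σ j) (ha : 0 ≤ a)
    (hk : 1 ≤ k) (hε0 : 0 < ε) (hε : ε ≤ 1)
    (hka : k * a ^ 2 = ε * tailSq (conjDiag U σ) k / 256) (h0 : ∀ i, 0 ≤ p i)
    (h1 : ∑ i, p i = 1) (ht : 0 < t) (hn : 2 ≤ n) (hc : 2000000 ≤ c) (hL0 : 0 < L)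
    (hL : L * (c * Real.log n) ≤ ε ^ 2)
    (hβ : ∀ i, (ridgeRoot U σ a * ridgeRoot U σ a) i i ≤ L * (t * p i)) :
    pairProb p t (fun x y => ¬ ∃ Δ : ℝ, |Δ| ≤ 600 * tailSq (conjDiag U σ) k ∧
      ∀ P : Matrix (Fin t) (Fin t) ℝ, IsOrthProjOfRank k P →
        (1 - ε) * frobSq (conjDiag U σ * samplingMatrix p x * (1 - P)) ≤
          frobSq ((samplingMatrix p y)ᵀ * conjDiag U σ * samplingMatrix p x * (1 - P)) + Δ ∧
        frobSq ((samplingMatrix p y)ᵀ * conjDiag U σ * samplingMatrix p x * (1 - P)) + Δ ≤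
          (1 + ε) * frobSq (conjDiag U σ * samplingMatrix p x * (1 - P))) ≤ 1 / 100 := by
  have hgood := fun x y : Fin t → Fin n => exists_shift_of_good_samples (k := k)
    (S := samplingMatrix p x) (R := samplingMatrix p y) hU hσ ha hε0 hε hka
  have htail := frobSq_tail_le (k := k) hU hσ ha
  have hT0 : 0 ≤ tailSq (conjDiag U σ) k := tailSq_nonneg _ _
  have hspec := (sampleProb_quadForm_sampling_le h0 h1 ht ridgeRoot_transpose
    (quadForm_ridgeRoot_le hU hσ ha) hL0 hβ (δ := ε / 16) (by positivity) (by linarith)).trans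
    (two_mul_card_mul_exp_le hn hL0 hc hL)
  have hNAt : ((1 - headProj U σ a) * conjDiag U σ)ᵀ = (1 - headProj U σ a) * conjDiag U σ := by
    rw [one_sub_headProj_mul hU, conjDiag_transpose]
  have hNrow := sum_tail_sq_le hU hσ ha
  have hQrow := sum_headProj_sq_le hU hσ ha
  have hQN : headProj U σ a * (1 - headProj U σ a) = 0 := by
    rw [Matrix.mul_sub, headProj_mul_self hU, Matrix.mul_one, sub_self]
  set A := conjDiag U σ
  set Q := headProj U σ a
  set T := tailSq A k
  have hk0 : (1 : ℝ) ≤ k := by exact_mod_cast hk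
  have hεT : ε * T ≤ T := by nlinarith
  have ha2 : a ^ 2 ≤ T / 256 := by nlinarith [sq_nonneg a]
  have hfT : frobSq ((1 - Q) * A) ≤ 2 * T := by linarith
  have hn' : (2 : ℝ) ≤ n := by exact_mod_cast hn
  have hlog : 0.69 ≤ Real.log n := by
    have := Real.log_two_gt_d9
    have := Real.log_le_log two_pos hn'
    linarith
  have hLε : 1024000 * L ≤ ε ^ 2 := by
    have : 1380000 ≤ c * Real.log n := by nlinarith
    nlinarith
  have hε2 : ε ^ 2 ≤ 1 := by nlinarith
  have hQK : ∀ i, ∑ b, Q b i ^ 2 ≤ (2 * L) * (t * p i) := fun i => by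
    linarith [hQrow i, hβ i]
  have hNK : ∀ i, ∑ b, ((1 - Q) * A) i b ^ 2 ≤ (2 * a ^ 2 * L) * (t * p i) := fun i => by
    refine (hNrow i).trans ?_
    rw [mul_assoc (2 * a ^ 2)]
    exact mul_le_mul_of_nonneg_left (hβ i) (by positivity)
  -- Markov's inequality at level `1 / 1000` is applied to means of at most `2 * L * (2 * T)`.
  have hLT : 4000 * (L * T) ≤ ε ^ 2 * T / 256 := by nlinarith
  -- The mean mass of the tail does not grow under column sampling.
  have hmass : sampleExp p t (fun x => frobSq ((1 - Q) * (A * samplingMatrix p x)))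
      ≤ frobSq ((1 - Q) * A) := by
    refine le_trans (le_of_eq (congrArg _ (funext fun x => ?_)))
      (sampleExp_frobSq_le (t := t) h0 h1 ((1 - Q) * A))
    rw [← frobSq_transpose, ← Matrix.mul_assoc, Matrix.transpose_mul, hNAt]
  have hcross : ∀ {m : ℕ} (M : Matrix (Fin n) (Fin m) ℝ), sampleExp p t (fun x =>
      frobSq (Q * (samplingMatrix p x * (samplingMatrix p x)ᵀ) * ((1 - Q) * M)))
        ≤ 2 * L * frobSq ((1 - Q) * M) := fun M =>
    sampleExp_frobSq_mul_sampling_mul_le h0 h1 ht Q ((1 - Q) * M)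
      (by rw [← Matrix.mul_assoc, hQN, Matrix.zero_mul]) (by positivity) hQK
  have hB1 : pairProb p t (fun x _ => ¬ ∀ v, |v ⬝ᵥ (ridgeRoot U σ a * (samplingMatrix p x *
      (samplingMatrix p x)ᵀ - 1) * ridgeRoot U σ a) *ᵥ v| ≤ ε / 16 * (v ⬝ᵥ v)) ≤ 1 / 1000 :=
    (pairProb_left h1 _).trans_le hspec
  have hB2 : pairProb p t (fun _ y => ¬ ∀ v, |v ⬝ᵥ (ridgeRoot U σ a * (samplingMatrix p y *
      (samplingMatrix p y)ᵀ - 1) * ridgeRoot U σ a) *ᵥ v| ≤ ε / 16 * (v ⬝ᵥ v)) ≤ 1 / 1000 :=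
    (pairProb_right h1 _).trans_le hspec
  have hB3 := pairProb_lt_le (t := t) h0 (c := 1000) (b := ε ^ 2 * T / 256)
    (f := fun x _ => frobSq (Q * (samplingMatrix p x * (samplingMatrix p x)ᵀ) * ((1 - Q) * A)))
    (fun _ _ => frobSq_nonneg _) (by norm_num)
    (by simp only [sampleExp_const h1]; exact hcross A) (by nlinarith)
  have hB4 := pairProb_lt_le (t := t) h0 (c := 1000) (b := ε ^ 2 * T / 256)
    (f := fun x y => frobSq (Q * (samplingMatrix p y * (samplingMatrix p y)ᵀ) *
      ((1 - Q) * (A * samplingMatrix p x))))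
    (fun _ _ => frobSq_nonneg _) (by norm_num) (m := 2 * L * frobSq ((1 - Q) * A))
    (by
      refine (sampleExp_mono h0 fun x => hcross (A * samplingMatrix p x)).trans ?_
      rw [sampleExp_const_mul]
      gcongr)
    (by nlinarith)
  have hB5 := pairProb_lt_le (t := t) h0 (c := 1000) (b := (T / 8) ^ 2)
    (f := fun x _ => (frobSq ((samplingMatrix p x)ᵀ * ((1 - Q) * A)) - frobSq ((1 - Q) * A)) ^ 2)
    (fun _ _ => sq_nonneg _) (by norm_num)
    (by
      simp only [sampleExp_const h1]
      exact sampleExp_frobSq_sub_sq_le h0 h1 ht ((1 - Q) * A) (by positivity) hNK)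
    (by
      have h2 : 2 * a ^ 2 * L ≤ T * L / 128 := by nlinarith
      have h3 : 2 * a ^ 2 * L * frobSq ((1 - Q) * A) ≤ T * L / 128 * (2 * T) :=
        mul_le_mul h2 hfT (frobSq_nonneg _) (by positivity)
      nlinarith [mul_nonneg hT0 hT0])
  have hB6 := pairProb_lt_le (t := t) h0 (c := 300) (b := 600 * T)
    (f := fun x y => frobSq ((samplingMatrix p y)ᵀ * ((1 - Q) * (A * samplingMatrix p x))))
    (fun _ _ => frobSq_nonneg _) (by norm_num) (m := frobSq ((1 - Q) * A))
    ((sampleExp_mono h0 fun x => sampleExp_frobSq_le h0 h1 _).trans hmass) (by linarith)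
  -- The failure probabilities add up to `5 / 1000 + 1 / 300`.
  refine (pairProb_mono h0 fun x y hxy => ?_).trans ((pairProb_or_le h0 _ _).trans
    ((add_le_add hB1 ((pairProb_or_le h0 _ _).trans (add_le_add hB2 ((pairProb_or_le h0 _ _).trans
    (add_le_add hB3 ((pairProb_or_le h0 _ _).trans (add_le_add hB4
    ((pairProb_or_le h0 _ _).trans (add_le_add hB5 hB6))))))))).trans (by norm_num)))
  by_contra! hcon
  obtain ⟨g1, g2, g3, g4, g5, g6⟩ := hcon
  exact hxy (hgood x y g1 g2 g3 g4 g5 g6)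

end

end

open scoped Matrix in
theorem mainTheorem7 :
    ∃ c₀ c₀' : ℝ, 0 < c₀ ∧ 0 < c₀' ∧
      ∀ c c' : ℝ, c₀ ≤ c → c₀' ≤ c' →
      ∀ (n k : ℕ) (ε : ℝ), 1 ≤ k → 0 < ε → ε ≤ 1 → (k : ℝ) / ε ≤ n →
      ∀ A : Matrix (Fin n) (Fin n) ℝ, A.PosSemidef →
      ∀ τ l p : Fin n → ℝ,
        (∀ i, ridgeScore ⌈c * k / ε⌉₊ (CFC.sqrt A) i ≤ τ i) →
        (∀ i, l i = √(16 * n * ε / k) * τ i) →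
        (∀ i, p i = l i / ∑ i', l i') →
      ∀ t : ℕ, t = ⌈c' * Real.log n / ε ^ 2 * ∑ i, l i⌉₊ →
      ∀ {Ω : Type*} [MeasurableSpace Ω] (μ : Measure Ω) [IsProbabilityMeasure μ]
        (s₁ s₂ : Fin t → Ω → Fin n),
        (∀ j, Measurable (s₁ j)) → (∀ j, Measurable (s₂ j)) →
        iIndepFun (Sum.elim s₁ s₂) μ →
        (∀ j i, μ.real {ω | s₁ j ω = i} = p i) →
        (∀ j i, μ.real {ω | s₂ j ω = i} = p i) →
        99 / 100 ≤ μ.real {ω | ∃ Δ : ℝ, |Δ| ≤ 600 * tailSq A k ∧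
          ∀ S₁ S₂ : Matrix (Fin n) (Fin t) ℝ,
            S₁ = samplingMatrix p (fun j => s₁ j ω) →
            S₂ = samplingMatrix p (fun j => s₂ j ω) →
          ∀ P : Matrix (Fin t) (Fin t) ℝ, IsOrthProjOfRank k P →
            (1 - ε) * frobSq (A * S₁ * (1 - P)) ≤
              frobSq (S₂.transpose * A * S₁ * (1 - P)) + Δ ∧
            frobSq (S₂.transpose * A * S₁ * (1 - P)) + Δ ≤
              (1 + ε) * frobSq (A * S₁ * (1 - P))} := by
  refine ⟨512, 2000000, by norm_num, by norm_num, ?_⟩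
  intro c c' hc hc' n k ε hk hε0 hε hkn A hA τ l p hτ hl hp t ht Ω _ μ _ s₁ s₂ hm₁ hm₂ hind hp₁ hp₂
  rcases Nat.eq_zero_or_pos t with ht0 | ht0
  · -- There is no projection of rank `k ≥ 1` on the zero space.
    have huniv : {ω | ∃ Δ : ℝ, |Δ| ≤ 600 * tailSq A k ∧
          ∀ S₁ S₂ : Matrix (Fin n) (Fin t) ℝ,
            S₁ = samplingMatrix p (fun j => s₁ j ω) →
            S₂ = samplingMatrix p (fun j => s₂ j ω) →
          ∀ P : Matrix (Fin t) (Fin t) ℝ, IsOrthProjOfRank k P →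
            (1 - ε) * frobSq (A * S₁ * (1 - P)) ≤
              frobSq (S₂.transpose * A * S₁ * (1 - P)) + Δ ∧
            frobSq (S₂.transpose * A * S₁ * (1 - P)) + Δ ≤
              (1 + ε) * frobSq (A * S₁ * (1 - P))} = Set.univ := by
      refine Set.eq_univ_of_forall fun ω => ⟨0, ?_, ?_⟩
      · rw [abs_zero]; exact mul_nonneg (by norm_num) (tailSq_nonneg _ _)
      · intro S₁ S₂ _ _ P hP
        have h := P.rank_le_width
        have := hP.2.2
        omega
    rw [huniv, probReal_univ]
    norm_num
  obtain ⟨U, σ, hU, rfl⟩ := exists_eq_conjDiag (A := A) (by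
    have := hA.isHermitian
    rwa [Matrix.IsHermitian, Matrix.conjTranspose_eq_transpose_of_trivial] at this)
  have hσ : ∀ j, 0 ≤ σ j := fun j => by
    have := hA.dotProduct_mulVec_nonneg (U.col j)
    rwa [star_trivial, col_dotProduct_conjDiag hU] at this
  have hk0 : (1 : ℝ) ≤ k := by exact_mod_cast hk
  have hT0 := tailSq_nonneg (conjDiag U σ) k
  set a := √(ε * tailSq (conjDiag U σ) k / (256 * k)) with ha_def
  have ha : 0 ≤ a := Real.sqrt_nonneg _
  have hka : k * a ^ 2 = ε * tailSq (conjDiag U σ) k / 256 := by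
    rw [ha_def, Real.sq_sqrt (by positivity)]; field_simp
  have hR : 1 ≤ √(16 * n * ε / k) := by
    rw [Real.one_le_sqrt, le_div_iff₀ (by linarith)]
    rw [div_le_iff₀ hε0] at hkn
    nlinarith
  have hk' : 512 * k / ε ≤ (⌈c * k / ε⌉₊ : ℝ) := by
    refine le_trans ?_ (Nat.le_ceil _)
    gcongr
  have hβl : ∀ i, (ridgeRoot U σ a * ridgeRoot U σ a) i i ≤ l i := fun i => by
    rw [hl]
    exact (ridgeRoot_diag_le hU hσ ha hR
      (tailSq_sqrt_div_le hU hσ ha hk hε0 hε hka hk') i).trans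
      (mul_le_mul_of_nonneg_left (hτ i) (Real.sqrt_nonneg _))
  have hl0 : ∀ i, 0 ≤ l i := fun i => by
    refine le_trans ?_ (hβl i)
    rw [ridgeRoot_mul_self hU hσ ha, conjDiag_diag]
    exact Finset.sum_nonneg fun j _ =>
      mul_nonneg (div_nonneg (hσ j) (add_nonneg (hσ j) ha)) (sq_nonneg _)
  have hpos : 0 < c' * Real.log n / ε ^ 2 * ∑ i, l i := by
    rw [ht] at ht0; exact Nat.ceil_pos.mp ht0
  have hl0' : 0 ≤ ∑ i, l i := Finset.sum_nonneg fun i _ => hl0 i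
  have hlsum : 0 < ∑ i, l i := by
    refine lt_of_le_of_ne hl0' fun h => ?_
    rw [← h, mul_zero] at hpos
    exact hpos.false
  have hn2 : 2 ≤ n := by
    by_contra! hcon
    have : Real.log n = 0 := by
      rcases (by omega : n = 0 ∨ n = 1) with h | h <;> rw [h] <;> simp
    rw [this] at hpos
    simp at hpos
  have ht' : (0 : ℝ) < t := by exact_mod_cast ht0
  have hp0 : ∀ i, 0 ≤ p i := fun i => by rw [hp]; exact div_nonneg (hl0 i) hl0'
  have hp1 : ∑ i, p i = 1 := by
    simp only [hp, ← Finset.sum_div]; exact div_self hlsum.ne'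
  have hL : (∑ i, l i) / t * (c' * Real.log n) ≤ ε ^ 2 := by
    have h1 : c' * Real.log n / ε ^ 2 * ∑ i, l i ≤ t := by rw [ht]; exact Nat.le_ceil _
    rw [div_mul_eq_mul_div, div_le_iff₀ ht']
    rw [div_mul_eq_mul_div, div_le_iff₀ (by positivity)] at h1
    linarith
  have hmain := pairProb_not_exists_shift_le (t := t) hU hσ ha hk hε0 hε hka hp0 hp1 ht0 hn2 hc'
    (div_pos hlsum ht') hL (fun i => (hβl i).trans (le_of_eq (by
      rw [hp]; field_simp)))
  have hadd := pairProb_add_pairProb_not (t := t) hp1 (fun x y => ∃ Δ : ℝ,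
    |Δ| ≤ 600 * tailSq (conjDiag U σ) k ∧
      ∀ P : Matrix (Fin t) (Fin t) ℝ, IsOrthProjOfRank k P →
        (1 - ε) * frobSq (conjDiag U σ * samplingMatrix p x * (1 - P)) ≤
          frobSq ((samplingMatrix p y)ᵀ * conjDiag U σ * samplingMatrix p x * (1 - P)) + Δ ∧
        frobSq ((samplingMatrix p y)ᵀ * conjDiag U σ * samplingMatrix p x * (1 - P)) + Δ ≤
          (1 + ε) * frobSq (conjDiag U σ * samplingMatrix p x * (1 - P)))
  rw [← measureReal_eq_pairProb μ s₁ s₂ hm₁ hm₂ hind hp₁ hp₂] at hadd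
  rw [← eq_sub_iff_add_eq] at hadd
  refine le_trans (by linarith) (hadd.symm.le.trans (measureReal_mono ?_))
  rintro ω ⟨Δ, hΔ, h⟩
  refine ⟨Δ, hΔ, ?_⟩
  rintro _ _ rfl rfl P hP
  exact h P hP
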